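/- Let $n,k$ be natural numbers and let $M$ be a smooth (Hausdorff) manifold of dimension $n(k+1)$ with a $k$-symplectic structure $(\omega_1,\dots,\omega_k,\mathcal F)$: the $\omega_\alpha$ are closed smooth $2$-forms, $\mathcal F$ is a foliation with leaves of dimension $nk$ and tangent bundle $L=T\mathcal F$, $\bigcap_{\alpha} C_x(\omega_\alpha)=\{0\}$ for all $x\in M$, where $C_x(\omega)=\{v\in T_xM:\omega_x(v,w)=0\ \forall w\in T_xM\}$, and $\omega_\alpha(X,X')=0$ for all $\alpha$ and all $X,X'\in\Gamma(L)$. Put $L_\alpha=L\cap\bigcap_{\beta\ne\alpha}C(\omega_\beta)$. Let $Q$ be an integrable smooth distribution of rank $n$ with $TM=L\oplus Q$, let $\mathcal G$ be the foliation integral to $Q$, and suppose that (i) $\omega_\alpha(Y,Y')=0$ for all $\alpha$ and all $Y,Y'\in\Gamma(Q)$; (ii) $[X,Y]\in\Gamma(L_\alpha\oplus Q)$ for all $\alpha$, $X\in\Gamma(L_\alpha)$, $Y\in\Gamma(Q)$; (iii) for all $Y,Y'\in\Gamma(Q)$ the vector field $(i_\alpha^*)^{-1}(\psi_\alpha^{YY'})\in\Gamma(Q)$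 is the same for all $\alpha$, where $\psi_\alpha^{YY'}(V)=Y(\omega_\alpha(Y',V))-\omega_\alpha(Y',[Y,V])$ and $i_\alpha^*:Q\to L_\alpha^*$ is the isomorphism $i_\alpha^*(Y)(X)=\omega_\alpha(Y,X)$. Then there is a unique linear connection $\nabla$ on $M$ (the canonical connection) such that $\nabla L_\alpha\subset L_\alpha$ for every $\alpha$ and $\nabla Q\subset Q$, $\nabla\omega_1=\cdots=\nabla\omega_k=0$, and its torsion $T$ satisfies $T(X,Y)=0$ for all $X\in\Gamma(L)$, $Y\in\Gamma(Q)$. Its curvature tensor field $R$ vanishes along the leaves of $\mathcal F$ and of $\mathcal G$: $R_{X,X'}V=0$ for all $X,X'\in\Gamma(L)$ and $V\in\Gamma(TM)$, and $R_{Y,Y'}V=0$ for all $Y,Y'\in\Gamma(Q)$ and $V\in\Gamma(TM)$. Consequently every leaf (more generally, every injectively immersed integral manifold) $N$ of $\mathcal F$ or of $\mathcal G$ carries a canonical flat affine structure: $\nabla$ restricts to a unique linear connection on $N$, and this restriction has zero torsion and zero curvature. -/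

import Mathlib

open scoped Manifold ContDiff Topology
open VectorField

noncomputable section

namespace KSymp

/-! ### Vector fields, distributions, connections -/

section Basic

variable {E : Type*} [NormedAddCommGroup E] [NormedSpace ℝ E]
  {M : Type*} [TopologicalSpace M] [ChartedSpace E M]

variable (E M) in
/-- Vector fields on `M` (no regularity). The manifold `M` is modelled on the vector space `E`. -/
abbrev VF : Type _ := ∀ x : M, TangentSpace 𝓘(ℝ, E) x

variable (E M) in
/-- A field of tangent subspaces on `M`. -/
abbrev Distr : Type _ := ∀ x : M, Submodule ℝ (TangentSpace 𝓘(ℝ, E) x)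

variable (E M) in
/-- A field of bilinear forms on the tangent spaces of `M`. -/
abbrev BilinField : Type _ :=
  ∀ x : M, TangentSpace 𝓘(ℝ, E) x →L[ℝ] TangentSpace 𝓘(ℝ, E) x →L[ℝ] ℝ

/-- Smooth vector fields, `X ∈ Γ(TM)`. -/
def IsSmoothVF [IsManifold 𝓘(ℝ, E) ∞ M] (X : VF E M) : Prop :=
  ContMDiff 𝓘(ℝ, E) 𝓘(ℝ, E).tangent ∞ (fun x ↦ (⟨x, X x⟩ : TangentBundle 𝓘(ℝ, E) M))

/-- `X ∈ Γ(D)`: `X` is a smooth vector field with values in `D`. -/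
def IsSection [IsManifold 𝓘(ℝ, E) ∞ M] (D : Distr E M) (X : VF E M) : Prop :=
  IsSmoothVF X ∧ ∀ x, X x ∈ D x

/-- `D` is a smooth distribution of rank `r`: near every point it has a smooth frame of `r`
vector fields. -/
def IsSmoothDistribution [IsManifold 𝓘(ℝ, E) ∞ M] (r : ℕ) (D : Distr E M) : Prop :=
  ∀ x₀ : M, ∃ U : Set M, IsOpen U ∧ x₀ ∈ U ∧ ∃ s : Fin r → VF E M,
    (∀ i, ContMDiffOn 𝓘(ℝ, E) 𝓘(ℝ, E).tangent ∞
      (fun x ↦ (⟨x, s i x⟩ : TangentBundle 𝓘(ℝ, E) M)) U) ∧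
    ∀ x ∈ U, LinearIndependent ℝ (fun i ↦ s i x) ∧
      Submodule.span ℝ (Set.range fun i ↦ s i x) = D x

/-- `D` is the tangent bundle of a foliation with leaves of dimension `r`, that is, a smooth
distribution of rank `r` that is closed under Lie brackets (integrable, by Frobenius). -/
structure IsFoliation [IsManifold 𝓘(ℝ, E) ∞ M] (r : ℕ) (D : Distr E M) : Prop where
  smooth : IsSmoothDistribution r D
  involutive : ∀ X Y : VF E M, IsSection D X → IsSection D Y →
    ∀ x, mlieBracket 𝓘(ℝ, E) X Y x ∈ D x

/-- The derivative at `x` of a real function `f` in the direction of `v ∈ T_x M`. -/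
def dirDeriv (f : M → ℝ) (x : M) (v : TangentSpace 𝓘(ℝ, E) x) : ℝ :=
  mfderiv 𝓘(ℝ, E) 𝓘(ℝ, ℝ) f x v

/-- `Ω` is a closed smooth 2-form. Closedness is `dΩ = 0`, with `dΩ` evaluated on vector fields
through the invariant formula for the exterior derivative. -/
structure IsClosedTwoForm [IsManifold 𝓘(ℝ, E) ∞ M] (Ω : BilinField E M) : Prop where
  smooth : ContMDiff 𝓘(ℝ, E) (𝓘(ℝ, E).prod 𝓘(ℝ, E →L[ℝ] E →L[ℝ] ℝ)) ∞
    (fun x ↦ Bundle.TotalSpace.mk' (E →L[ℝ] E →L[ℝ] ℝ)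
      (E := fun x : M ↦ TangentSpace 𝓘(ℝ, E) x →L[ℝ] TangentSpace 𝓘(ℝ, E) x →L[ℝ] ℝ) x (Ω x))
  alternating : ∀ x v, Ω x v v = 0
  closed : ∀ X Y Z : VF E M, IsSmoothVF X → IsSmoothVF Y → IsSmoothVF Z → ∀ x,
    dirDeriv (fun y ↦ Ω y (Y y) (Z y)) x (X x)
      - dirDeriv (fun y ↦ Ω y (X y) (Z y)) x (Y x)
      + dirDeriv (fun y ↦ Ω y (X y) (Y y)) x (Z x)
      - Ω x (mlieBracket 𝓘(ℝ, E) X Y x) (Z x)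
      + Ω x (mlieBracket 𝓘(ℝ, E) X Z x) (Y x)
      - Ω x (mlieBracket 𝓘(ℝ, E) Y Z x) (X x) = 0

variable (E M) in
/-- Linear connections on `TM`; `cov W x v` is `(∇_v W)(x)`. -/
abbrev LinConn [IsManifold 𝓘(ℝ, E) ∞ M] : Type _ :=
  CovariantDerivative 𝓘(ℝ, E) E (TangentSpace 𝓘(ℝ, E) : M → Type _)

/-- The curvature `R_{X,Y} Z = ∇_X ∇_Y Z - ∇_Y ∇_X Z - ∇_{[X,Y]} Z` on vector fields. -/
def curvature [IsManifold 𝓘(ℝ, E) ∞ M] (cov : LinConn E M) (X Y Z : VF E M) : VF E M := fun x ↦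
  cov (fun y ↦ cov Z y (Y y)) x (X x) - cov (fun y ↦ cov Z y (X y)) x (Y x)
    - cov Z x (mlieBracket 𝓘(ℝ, E) X Y x)

/-- A smooth connection: it maps smooth vector fields to smooth tensor fields. -/
def IsSmoothConn [IsManifold 𝓘(ℝ, E) ∞ M] (cov : LinConn E M) : Prop :=
  CovariantDerivative.ContMDiffCovariantDerivative cov ∞

end Basic

/-! ### `k`-symplectic structures and transversal distributions -/

section KSymplectic

variable {E : Type*} [NormedAddCommGroup E] [NormedSpace ℝ E]
  {M : Type*} [TopologicalSpace M] [ChartedSpace E M]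
  {n k : ℕ}

/-- The characteristic space `C_x(Ω) = {v : Ω_x(v, w) = 0 for all w}`. -/
def charSpace (Ω : BilinField E M) (x : M) : Submodule ℝ (TangentSpace 𝓘(ℝ, E) x) :=
  LinearMap.ker (Ω x).toLinearMap

/-- A `k`-symplectic structure `(Ω₁, …, Ω_k, 𝓕)` on a manifold of dimension `n (k + 1)`;
`L` is the tangent bundle of the foliation `𝓕`, whose leaves have dimension `n k`. -/
structure IsKSymplectic [IsManifold 𝓘(ℝ, E) ∞ M] (n k : ℕ)
    (Ω : Fin k → BilinField E M) (L : Distr E M) : Prop where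
  dim : Module.finrank ℝ E = n * (k + 1)
  form : ∀ α, IsClosedTwoForm (Ω α)
  foliation : IsFoliation (n * k) L
  nondegenerate : ∀ x, ⨅ α, charSpace (Ω α) x = ⊥
  isotropic : ∀ α x, ∀ v ∈ L x, ∀ w ∈ L x, Ω α x v w = 0

/-- The subbundle `L_α = ⋂_{β ≠ α} C(Ω_β)` of `L`. For `k ≥ 2` the intersection lies in `L`
anyway; for `k = 1` it is empty and `L_1 = L`. -/
def subL (Ω : Fin k → BilinField E M) (L : Distr E M) (α : Fin k) : Distr E M := fun x ↦
  L x ⊓ ⨅ β, ⨅ _ : β ≠ α, charSpace (Ω β) x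

/-- `ψ^{Y Y'}(V) = (𝓛_Y i_{Y'} Ω)(V) = Y(Ω(Y', V)) - Ω(Y', [Y, V])`. -/
def psi (Ω : BilinField E M) (Y Y' V : VF E M) (x : M) : ℝ :=
  dirDeriv (fun y ↦ Ω y (Y' y) (V y)) x (Y x) - Ω x (Y' x) (mlieBracket 𝓘(ℝ, E) Y V x)

/-- `q ∈ Q_x` is the value at `x` of `(i_α^*)⁻¹(ψ_α^{Y Y'})`, where `i_α^* : Q → L_α^*` is
`i_α^*(q)(X) = Ω_α(q, X)`. -/
def IsPsiPreimage [IsManifold 𝓘(ℝ, E) ∞ M] (Ω : Fin k → BilinField E M) (L Q : Distr E M)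
    (α : Fin k) (Y Y' : VF E M) (x : M) (q : TangentSpace 𝓘(ℝ, E) x) : Prop :=
  q ∈ Q x ∧ ∀ X : VF E M, IsSection (subL Ω L α) X → Ω α x q (X x) = psi (Ω α) Y Y' X x

/-- The standing assumptions on the distribution `Q`: it is integrable of rank `n`, transversal
to `𝓕`, satisfies (i) and (ii), and the vector fields `(i_α^*)⁻¹(ψ_α^{Y Y'})` do not depend
on `α`. -/
structure IsAdmissible [IsManifold 𝓘(ℝ, E) ∞ M] (n : ℕ)
    (Ω : Fin k → BilinField E M) (L Q : Distr E M) : Prop where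
  foliation : IsFoliation n Q
  transversal : ∀ x, IsCompl (L x) (Q x)
  isotropic : ∀ α x, ∀ v ∈ Q x, ∀ w ∈ Q x, Ω α x v w = 0
  bracket : ∀ α (X Y : VF E M), IsSection (subL Ω L α) X → IsSection Q Y →
    ∀ x, mlieBracket 𝓘(ℝ, E) X Y x ∈ subL Ω L α x ⊔ Q x
  psi_eq : ∀ Y Y' : VF E M, IsSection Q Y → IsSection Q Y' → ∀ x α β,
    ∀ q q' : TangentSpace 𝓘(ℝ, E) x,
      IsPsiPreimage Ω L Q α Y Y' x q → IsPsiPreimage Ω L Q β Y Y' x q' → q = q'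

/-- The properties that characterize the canonical connection: it preserves every `L_α` and `Q`,
every `Ω_α` is parallel, and `T(X, Y) = 0` for `X ∈ L`, `Y ∈ Q`. -/
structure IsCanonicalConnection [FiniteDimensional ℝ E] [IsManifold 𝓘(ℝ, E) ∞ M]
    (Ω : Fin k → BilinField E M) (L Q : Distr E M) (cov : LinConn E M) : Prop where
  smooth : IsSmoothConn cov
  preserves_subL : ∀ α (X : VF E M), IsSection (subL Ω L α) X →
    ∀ x v, cov X x v ∈ subL Ω L α x
  preserves_Q : ∀ Y : VF E M, IsSection Q Y → ∀ x v, cov Y x v ∈ Q x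
  parallel : ∀ α (W W' : VF E M), IsSmoothVF W → IsSmoothVF W' → ∀ x v,
    dirDeriv (fun y ↦ Ω α y (W y) (W' y)) x v
      = Ω α x (cov W x v) (W' x) + Ω α x (W x) (cov W' x v)
  torsion : ∀ x, ∀ u ∈ L x, ∀ v ∈ Q x, cov.torsion x u v = 0

end KSymplectic

/-! ### Leaves and flat affine structures -/

section Leaves

variable {E : Type*} [NormedAddCommGroup E] [NormedSpace ℝ E]
  {M : Type*} [TopologicalSpace M] [ChartedSpace E M]
  {F : Type*} [NormedAddCommGroup F] [NormedSpace ℝ F]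
  {N : Type*} [TopologicalSpace N] [ChartedSpace F N]

variable (F) in
/-- `ι : N → M` is an integral manifold of `D`, i.e. an injectively immersed submanifold with
`T N = D` along `N`. The leaves of a foliation are its maximal connected integral manifolds. -/
structure IsIntegralManifold (D : Distr E M) (ι : N → M) : Prop where
  injective : Function.Injective ι
  smooth : ContMDiff 𝓘(ℝ, F) 𝓘(ℝ, E) ∞ ι
  immersion : ∀ p, Function.Injective (mfderiv 𝓘(ℝ, F) 𝓘(ℝ, E) ι p)
  tangent : ∀ p, LinearMap.range (mfderiv 𝓘(ℝ, F) 𝓘(ℝ, E) ι p).toLinearMap = D (ι p)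

/-- `covN` is the restriction of `cov` to the immersed submanifold `ι : N → M`: if the vector
fields `Z` on `N` and `W` on `M` are `ι`-related near `p`, then
`dι (∇^N_u Z) = ∇_{dι u} W` for all `u ∈ T_p N`. -/
def IsRestriction [IsManifold 𝓘(ℝ, E) ∞ M] [IsManifold 𝓘(ℝ, F) ∞ N]
    (cov : LinConn E M) (ι : N → M) (covN : LinConn F N) : Prop :=
  ∀ (p : N) (Z : VF F N) (W : VF E M), IsSmoothVF Z → IsSmoothVF W →
    (∀ᶠ q in 𝓝 p, mfderiv 𝓘(ℝ, F) 𝓘(ℝ, E) ι q (Z q) = W (ι q)) →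
    ∀ u : TangentSpace 𝓘(ℝ, F) p,
      mfderiv 𝓘(ℝ, F) 𝓘(ℝ, E) ι p (covN Z p u)
        = cov W (ι p) (mfderiv 𝓘(ℝ, F) 𝓘(ℝ, E) ι p u)

/-- A flat affine structure on a manifold: a smooth linear connection whose torsion and curvature
vanish. -/
structure IsFlatAffineStructure [FiniteDimensional ℝ F] [IsManifold 𝓘(ℝ, F) ∞ N]
    (covN : LinConn F N) : Prop where
  smooth : IsSmoothConn covN
  torsion_free : ∀ p, covN.torsion p = 0
  flat : ∀ X Y Z : VF F N, IsSmoothVF X → IsSmoothVF Y → IsSmoothVF Z →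
    ∀ p, curvature covN X Y Z p = 0

variable (F) in
/-- The connection `cov` restricts to `ι : N → M`, its restriction is unique (as an operator on
smooth vector fields), and it is a flat affine structure on `N`. -/
def RestrictsToFlatAffineStructure [IsManifold 𝓘(ℝ, E) ∞ M] [FiniteDimensional ℝ F]
    [IsManifold 𝓘(ℝ, F) ∞ N] (cov : LinConn E M) (ι : N → M) : Prop :=
  ∃ covN : LinConn F N, IsRestriction cov ι covN ∧ IsFlatAffineStructure covN ∧
    ∀ covN' : LinConn F N, IsRestriction cov ι covN' →
      ∀ Z : VF F N, IsSmoothVF Z → ∀ p, covN' Z p = covN Z p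

end Leaves

end KSymp

end

/-! Let P and R be the projections of TM = L ⊕ Q onto L and Q. The required properties leave no
choice for ∇. For X in L and Y in Q, the identity ∇_X Y - ∇_Y X = [X, Y] has its two left-hand terms
in Q and in L, so ∇_X Y = R[X, Y] and ∇_Y X = P[Y, X]. Since Ω_α is parallel and L and Q are
isotropic, it follows that Ω_α(∇_X X', Y) = ψ_α^{X X'}(Y) for X, X' in L and Y in Q, and Ω_α(∇_Y Y',
X) = ψ_α^{Y Y'}(X) for Y, Y' in Q and X in L_α. By nondegeneracy these formulas, collected in
`IsAdaptedConn`, determine ∇ (`IsCanonicalConnection.isAdaptedConn`, `IsAdaptedConn.unique`).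

For existence the formulas are taken as the definition (`exists_isAdaptedConn`). On an isotropic
bundle, ψ^{A B}(V) is function-linear in V and A and obeys the Leibniz rule in B, and frames of the
L_α dual to a frame of Q (`exists_adapted_frame`) represent it by smooth sections. On L the k forms
ψ_α on Q define one section together. On Q each α gives a section of its own, and (iii) says that
these agree. Condition (ii) makes ∇_Y preserve each L_α (`IsAdaptedConn.mem_subL`).

Along L, the connection on Q is X ↦ R[X, ·], which is flat by the Jacobi identity and involutivity
(`curvature_eq_zero_of_bracket`). The curvature is skew for each parallel form (`curvature_skew`),
so flatness passes from Q to L. The same holds with L and Q exchanged. Closedness of the forms makes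
∇ torsion free along each foliation (`torsion_L`, `torsion_Q`).

On an integral manifold, ∇ is transported through ι-related vector fields: these exist locally, and
brackets and covariant derivatives respect the relation, so vanishing torsion and curvature descend
(`IsIntegralManifold.restrictsToFlatAffineStructure`). -/

noncomputable section

namespace KSymp

/-! ### Directional derivatives, smooth vector fields and Lie brackets. -/

section Calculus

variable {E : Type*} [NormedAddCommGroup E] [NormedSpace ℝ E]
  {M : Type*} [TopologicalSpace M] [ChartedSpace E M]

/-- Smooth real functions on `M`. -/
abbrev SmoothFn (f : M → ℝ) : Prop := ContMDiff 𝓘(ℝ, E) 𝓘(ℝ, ℝ) ∞ f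

lemma SmoothFn.mdiffAt {f : M → ℝ} (hf : SmoothFn (E := E) f) (x : M) :
    MDifferentiableAt 𝓘(ℝ, E) 𝓘(ℝ, ℝ) f x :=
  hf.mdifferentiableAt (by simp)

lemma dirDeriv_eq_mvfderiv (f : M → ℝ) (x : M) (v : TangentSpace 𝓘(ℝ, E) x) :
    dirDeriv f x v = mvfderiv 𝓘(ℝ, E) f x v := rfl

lemma dirDeriv_add_right (f : M → ℝ) (x : M) (v w : TangentSpace 𝓘(ℝ, E) x) :
    dirDeriv f x (v + w) = dirDeriv f x v + dirDeriv f x w := by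
  simp only [dirDeriv_eq_mvfderiv, map_add]

lemma dirDeriv_smul_right (f : M → ℝ) (x : M) (c : ℝ) (v : TangentSpace 𝓘(ℝ, E) x) :
    dirDeriv f x (c • v) = c * dirDeriv f x v := by
  simp only [dirDeriv_eq_mvfderiv, map_smul, smul_eq_mul]

lemma dirDeriv_zero_right (f : M → ℝ) (x : M) :
    dirDeriv f x (0 : TangentSpace 𝓘(ℝ, E) x) = 0 := by
  simp only [dirDeriv_eq_mvfderiv, map_zero]

lemma dirDeriv_sub_right (f : M → ℝ) (x : M) (v w : TangentSpace 𝓘(ℝ, E) x) :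
    dirDeriv f x (v - w) = dirDeriv f x v - dirDeriv f x w := by
  simp only [dirDeriv_eq_mvfderiv, map_sub]

lemma dirDeriv_add {f g : M → ℝ} {x : M} (hf : MDifferentiableAt 𝓘(ℝ, E) 𝓘(ℝ, ℝ) f x)
    (hg : MDifferentiableAt 𝓘(ℝ, E) 𝓘(ℝ, ℝ) g x) (v : TangentSpace 𝓘(ℝ, E) x) :
    dirDeriv (fun y ↦ f y + g y) x v = dirDeriv f x v + dirDeriv g x v := by
  simp only [dirDeriv_eq_mvfderiv]
  exact congrArg (fun l ↦ l v) (mvfderiv_add hf hg)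

lemma dirDeriv_neg {f : M → ℝ} {x : M} (v : TangentSpace 𝓘(ℝ, E) x) :
    dirDeriv (fun y ↦ -f y) x v = -dirDeriv f x v := by
  simp only [dirDeriv_eq_mvfderiv]
  exact congrArg (fun l : TangentSpace 𝓘(ℝ, E) x →L[ℝ] ℝ ↦ l v) (mvfderiv_neg (g := f))

lemma dirDeriv_sub {f g : M → ℝ} {x : M} (hf : MDifferentiableAt 𝓘(ℝ, E) 𝓘(ℝ, ℝ) f x)
    (hg : MDifferentiableAt 𝓘(ℝ, E) 𝓘(ℝ, ℝ) g x) (v : TangentSpace 𝓘(ℝ, E) x) :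
    dirDeriv (fun y ↦ f y - g y) x v = dirDeriv f x v - dirDeriv g x v := by
  simp only [dirDeriv_eq_mvfderiv]
  exact congrArg (fun l ↦ l v) (mvfderiv_sub hf hg)

lemma dirDeriv_mul {f g : M → ℝ} {x : M} (hf : MDifferentiableAt 𝓘(ℝ, E) 𝓘(ℝ, ℝ) f x)
    (hg : MDifferentiableAt 𝓘(ℝ, E) 𝓘(ℝ, ℝ) g x) (v : TangentSpace 𝓘(ℝ, E) x) :
    dirDeriv (fun y ↦ f y * g y) x v = f x * dirDeriv g x v + g x * dirDeriv f x v := by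
  simp only [dirDeriv_eq_mvfderiv]
  have := congrArg (fun l ↦ l v) (mvfderiv_mul hf hg)
  simpa using! this

lemma dirDeriv_const (c : ℝ) (x : M) (v : TangentSpace 𝓘(ℝ, E) x) :
    dirDeriv (fun _ ↦ c) x v = 0 := by
  simp only [dirDeriv_eq_mvfderiv]
  exact congrArg (fun l ↦ l v) (mvfderiv_const c)

lemma dirDeriv_congr {f g : M → ℝ} {x : M} (h : f =ᶠ[𝓝 x] g) (v : TangentSpace 𝓘(ℝ, E) x) :
    dirDeriv f x v = dirDeriv g x v := by
  have := h.mfderiv_eq (I := 𝓘(ℝ, E)) (I' := 𝓘(ℝ, ℝ))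
  unfold dirDeriv
  exact congrArg (fun l : E →L[ℝ] ℝ ↦ l v) this

lemma dirDeriv_sum {ι : Type*} (s : Finset ι) {f : ι → M → ℝ} {x : M}
    (hf : ∀ i, MDifferentiableAt 𝓘(ℝ, E) 𝓘(ℝ, ℝ) (f i) x) (v : TangentSpace 𝓘(ℝ, E) x) :
    dirDeriv (fun y ↦ ∑ i ∈ s, f i y) x v = ∑ i ∈ s, dirDeriv (f i) x v := by
  classical
  have key : MDifferentiableAt 𝓘(ℝ, E) 𝓘(ℝ, ℝ) (fun y ↦ ∑ i ∈ s, f i y) x ∧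
      dirDeriv (fun y ↦ ∑ i ∈ s, f i y) x v = ∑ i ∈ s, dirDeriv (f i) x v := by
    induction s using Finset.induction_on with
    | empty => simpa using ⟨mdifferentiableAt_const, dirDeriv_const 0 x v⟩
    | insert a s ha ih =>
      simp only [Finset.sum_insert ha]
      exact ⟨(hf a).add ih.1, by rw [dirDeriv_add (hf a) ih.1, ih.2]⟩
  exact key.2

variable [IsManifold 𝓘(ℝ, E) ∞ M]

lemma IsSmoothVF.mdiffAt {X : VF E M} (hX : IsSmoothVF X) (x : M) :
    MDifferentiableAt 𝓘(ℝ, E) 𝓘(ℝ, E).tangent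
      (fun x ↦ (⟨x, X x⟩ : TangentBundle 𝓘(ℝ, E) M)) x :=
  ContMDiff.mdifferentiableAt hX (by simp)

lemma IsSmoothVF.add {X Y : VF E M} (hX : IsSmoothVF X) (hY : IsSmoothVF Y) :
    IsSmoothVF (X + Y) := ContMDiff.add_section hX hY

lemma IsSmoothVF.sub {X Y : VF E M} (hX : IsSmoothVF X) (hY : IsSmoothVF Y) :
    IsSmoothVF (X - Y) := ContMDiff.sub_section hX hY

lemma IsSmoothVF.smul {f : M → ℝ} {X : VF E M} (hf : SmoothFn (E := E) f) (hX : IsSmoothVF X) :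
    IsSmoothVF (f • X) := ContMDiff.smul_section hf hX

lemma isSmoothVF_zero : IsSmoothVF (0 : VF E M) := Bundle.contMDiff_zeroSection ℝ _

lemma IsSmoothVF.sum {ι : Type*} {s : Finset ι} {X : ι → VF E M}
    (hX : ∀ i ∈ s, IsSmoothVF (X i)) : IsSmoothVF (fun x ↦ ∑ i ∈ s, X i x) :=
  ContMDiff.sum_section hX

lemma IsSmoothVF.mlieBracket [CompleteSpace E] {X Y : VF E M} (hX : IsSmoothVF X)
    (hY : IsSmoothVF Y) : IsSmoothVF (mlieBracket 𝓘(ℝ, E) X Y) := by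
  have : IsManifold 𝓘(ℝ, E) (((⊤ : ℕ∞) : ℕ∞ω) + 1) M := by
    change IsManifold 𝓘(ℝ, E) ∞ M; infer_instance
  have : IsManifold 𝓘(ℝ, E) (minSmoothness ℝ 2) M := by
    rw [minSmoothness_of_isRCLikeNormedField]; infer_instance
  exact ContDiff.mlieBracket_vectorField (n := ⊤) (m := ⊤) hX hY (by simp)

lemma SmoothFn.dirDeriv {f : M → ℝ} {X : VF E M} (hf : SmoothFn (E := E) f)
    (hX : IsSmoothVF X) : SmoothFn (E := E) (fun x ↦ dirDeriv f x (X x)) := by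
  have h1 : ContMDiff 𝓘(ℝ, E).tangent 𝓘(ℝ, ℝ).tangent ∞ (tangentMap 𝓘(ℝ, E) 𝓘(ℝ, ℝ) f) :=
    hf.contMDiff_tangentMap le_rfl
  exact (contMDiff_snd_tangentBundle_modelSpace ℝ 𝓘(ℝ, ℝ)).comp (h1.comp hX)

lemma IsClosedTwoForm.smoothFn {Ω : BilinField E M} (hΩ : IsClosedTwoForm Ω) {X Y : VF E M}
    (hX : IsSmoothVF X) (hY : IsSmoothVF Y) : SmoothFn (E := E) (fun x ↦ Ω x (X x) (Y x)) := by
  have := ContMDiff.clm_bundle_apply₂ (F₁ := E) (F₂ := E) (F₃ := ℝ)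
    (E₁ := fun x : M ↦ TangentSpace 𝓘(ℝ, E) x) (E₂ := fun x : M ↦ TangentSpace 𝓘(ℝ, E) x)
    (E₃ := Bundle.Trivial M ℝ) (b := fun x ↦ x)
    (ψ := Ω) (v := X) (w := Y) hΩ.smooth hX hY
  intro x
  exact (Bundle.contMDiffAt_section _).1 (this x)

lemma IsClosedTwoForm.neg_symm {Ω : BilinField E M} (hΩ : IsClosedTwoForm Ω) (x : M)
    (v w : TangentSpace 𝓘(ℝ, E) x) : Ω x v w = -Ω x w v := by
  have := hΩ.alternating x (v + w)
  simp only [map_add, add_apply, hΩ.alternating, zero_add, add_zero] at this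
  linarith

variable [CompleteSpace E]

lemma mlieBracket_smul_right' {f : M → ℝ} {X Y : VF E M} (hf : SmoothFn (E := E) f)
    (hY : IsSmoothVF Y) (x : M) :
    mlieBracket 𝓘(ℝ, E) X (f • Y) x = dirDeriv f x (X x) • Y x + f x • mlieBracket 𝓘(ℝ, E) X Y x :=
  mlieBracket_smul_right (hf.mdiffAt x) (hY.mdiffAt x)

lemma mlieBracket_smul_left' {f : M → ℝ} {X Y : VF E M} (hf : SmoothFn (E := E) f)
    (hX : IsSmoothVF X) (x : M) :
    mlieBracket 𝓘(ℝ, E) (f • X) Y x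
      = -dirDeriv f x (Y x) • X x + f x • mlieBracket 𝓘(ℝ, E) X Y x :=
  mlieBracket_smul_left (hf.mdiffAt x) (hX.mdiffAt x)

lemma mlieBracket_add_right' {X Y Y' : VF E M} (hY : IsSmoothVF Y) (hY' : IsSmoothVF Y') (x : M) :
    mlieBracket 𝓘(ℝ, E) X (Y + Y') x
      = mlieBracket 𝓘(ℝ, E) X Y x + mlieBracket 𝓘(ℝ, E) X Y' x :=
  mlieBracket_add_right (hY.mdiffAt x) (hY'.mdiffAt x)

lemma mlieBracket_add_left' {X X' Y : VF E M} (hX : IsSmoothVF X) (hX' : IsSmoothVF X') (x : M) :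
    mlieBracket 𝓘(ℝ, E) (X + X') Y x
      = mlieBracket 𝓘(ℝ, E) X Y x + mlieBracket 𝓘(ℝ, E) X' Y x :=
  mlieBracket_add_left (hX.mdiffAt x) (hX'.mdiffAt x)

lemma mlieBracket_jacobi {X Y Z : VF E M} (hX : IsSmoothVF X) (hY : IsSmoothVF Y)
    (hZ : IsSmoothVF Z) (x : M) :
    mlieBracket 𝓘(ℝ, E) X (mlieBracket 𝓘(ℝ, E) Y Z) x
      = mlieBracket 𝓘(ℝ, E) (mlieBracket 𝓘(ℝ, E) X Y) Z x
        + mlieBracket 𝓘(ℝ, E) Y (mlieBracket 𝓘(ℝ, E) X Z) x := by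
  have : IsManifold 𝓘(ℝ, E) (minSmoothness ℝ 3) M := by
    rw [minSmoothness_of_isRCLikeNormedField]
    exact IsManifold.of_le (n := ∞) (WithTop.coe_le_coe.2 le_top)
  have h2 : (minSmoothness ℝ 2 : ℕ∞ω) ≤ ∞ := by
    rw [minSmoothness_of_isRCLikeNormedField]; exact WithTop.coe_le_coe.2 le_top
  exact leibniz_identity_mlieBracket_apply ((hX x).of_le h2) ((hY x).of_le h2) ((hZ x).of_le h2)

end Calculus

/-! ### Bump functions, and global fields with prescribed values. -/

section Bump

variable {E : Type*} [NormedAddCommGroup E] [NormedSpace ℝ E] [FiniteDimensional ℝ E]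
  {M : Type*} [TopologicalSpace M] [T2Space M] [ChartedSpace E M] [IsManifold 𝓘(ℝ, E) ∞ M]

lemma exists_bump {U : Set M} {x : M} (hU : U ∈ 𝓝 x) :
    ∃ χ : M → ℝ, SmoothFn (E := E) χ ∧ χ =ᶠ[𝓝 x] 1 ∧ tsupport χ ⊆ U := by
  obtain ⟨f, -, hf⟩ := (SmoothBumpFunction.nhds_basis_tsupport (I := 𝓘(ℝ, E)) x).mem_iff.1 hU
  exact ⟨f, f.contMDiff, f.eventuallyEq_one, hf⟩

/-- A local smooth vector field agrees near a point with a global one, its product with a bump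
function. -/
lemma exists_bump_smul {U : Set M} (hU : IsOpen U) {x : M} (hx : x ∈ U) :
    ∃ χ : M → ℝ, SmoothFn (E := E) χ ∧ χ =ᶠ[𝓝 x] 1 ∧ (∀ y, y ∉ U → χ y = 0) ∧
      ∀ X : VF E M, ContMDiffOn 𝓘(ℝ, E) 𝓘(ℝ, E).tangent ∞
        (fun x ↦ (⟨x, X x⟩ : TangentBundle 𝓘(ℝ, E) M)) U → IsSmoothVF (χ • X) := by
  obtain ⟨χ, h1, h2, h3⟩ := exists_bump (E := E) (hU.mem_nhds hx)
  exact ⟨χ, h1, h2, fun y hy ↦ image_eq_zero_of_notMem_tsupport fun h ↦ hy (h3 h),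
    fun X hX ↦ ContMDiffOn.smul_section_of_tsupport h1.contMDiffOn hU h3 hX⟩

lemma exists_smoothVF_eq (x : M) (v : TangentSpace 𝓘(ℝ, E) x) :
    ∃ X : VF E M, IsSmoothVF X ∧ X x = v := by
  let e := trivializationAt E (TangentSpace 𝓘(ℝ, E) : M → Type _) x
  have hx : x ∈ e.baseSet := FiberBundle.mem_baseSet_trivializationAt' x
  obtain ⟨χ, h1, h2, h3, h4⟩ := exists_bump_smul (E := E) e.open_baseSet hx
  let b := Module.finBasis ℝ E
  refine ⟨fun y ↦ ∑ i, e.localFrameCoeff 𝓘(ℝ, E) b i x v • (χ • e.localFrame b i) y,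
    ?_, ?_⟩
  · refine IsSmoothVF.sum fun i _ ↦ ?_
    exact IsSmoothVF.smul (f := fun _ ↦ e.localFrameCoeff 𝓘(ℝ, E) b i x v) contMDiff_const
      (h4 _ (e.contMDiffOn_localFrame_baseSet _ b i))
  · have h := e.eq_sum_localFrameCoeff_smul (I := 𝓘(ℝ, E)) (b := b) (s := FiberBundle.extend E v)
      hx
    simp only [FiberBundle.extend_apply_self] at h
    conv_rhs => rw [h]
    simp [h2.self_of_nhds]

lemma IsSmoothDistribution.exists_section {r : ℕ} {D : Distr E M} (hD : IsSmoothDistribution r D)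
    (x : M) {v : TangentSpace 𝓘(ℝ, E) x} (hv : v ∈ D x) :
    ∃ X : VF E M, IsSection D X ∧ X x = v := by
  obtain ⟨U, hU, hx, s, hs, hsD⟩ := hD x
  obtain ⟨χ, h1, h2, h3, h4⟩ := exists_bump_smul (E := E) hU hx
  rw [← (hsD x hx).2, Submodule.mem_span_range_iff_exists_fun] at hv
  obtain ⟨c, hc⟩ := hv
  refine ⟨fun y ↦ ∑ i, c i • (χ • s i) y, ⟨?_, fun y ↦ ?_⟩, ?_⟩
  · refine IsSmoothVF.sum fun i _ ↦ ?_
    exact IsSmoothVF.smul (f := fun _ ↦ c i) contMDiff_const (h4 _ (hs i))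
  · refine Submodule.sum_mem _ fun i _ ↦ Submodule.smul_mem _ _ ?_
    by_cases hy : y ∈ U
    · rw [← (hsD y hy).2]
      exact Submodule.smul_mem _ _ (Submodule.subset_span ⟨i, rfl⟩)
    · simp [h3 y hy]
  · rw [← hc]; simp [h2.self_of_nhds]

/-- The Lie bracket is the commutator of derivations. -/
lemma dirDeriv_mlieBracket {f : M → ℝ} {X Y : VF E M} (hf : SmoothFn (E := E) f)
    (hX : IsSmoothVF X) (hY : IsSmoothVF Y) (x : M) :
    dirDeriv f x (mlieBracket 𝓘(ℝ, E) X Y x)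
      = dirDeriv (fun y ↦ dirDeriv f y (Y y)) x (X x)
        - dirDeriv (fun y ↦ dirDeriv f y (X y)) x (Y x) := by
  rcases subsingleton_or_nontrivial E with hE | hE
  · have h0 : ∀ v : TangentSpace 𝓘(ℝ, E) x, v = 0 := fun v ↦ hE.elim (α := E) v 0
    rw [h0 (mlieBracket 𝓘(ℝ, E) X Y x), h0 (X x), h0 (Y x)]
    simp only [dirDeriv_zero_right, sub_zero]
  obtain ⟨v, hv⟩ := exists_ne (0 : E)
  obtain ⟨Z, hZ, hZx⟩ := exists_smoothVF_eq (M := M) (E := E) x v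
  have hfX := hf.dirDeriv hX
  have hfY := hf.dirDeriv hY
  -- Comparing the Jacobi identity for X, Y, f • Z with f times the one for X, Y, Z leaves the claim
  -- multiplied by Z x, which is nonzero by the choice of Z.
  have J := mlieBracket_jacobi hX hY (hZ.smul hf) x
  have J0 := mlieBracket_jacobi hX hY hZ x
  have e1 : mlieBracket 𝓘(ℝ, E) Y (f • Z)
      = (fun y ↦ dirDeriv f y (Y y)) • Z + f • mlieBracket 𝓘(ℝ, E) Y Z :=
    funext fun y ↦ mlieBracket_smul_right' hf hZ y
  have e2 : mlieBracket 𝓘(ℝ, E) X (f • Z)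
      = (fun y ↦ dirDeriv f y (X y)) • Z + f • mlieBracket 𝓘(ℝ, E) X Z :=
    funext fun y ↦ mlieBracket_smul_right' hf hZ y
  rw [e1, e2, mlieBracket_smul_right' hf hZ,
    mlieBracket_add_right' (hZ.smul hfY) ((hY.mlieBracket hZ).smul hf),
    mlieBracket_add_right' (hZ.smul hfX) ((hX.mlieBracket hZ).smul hf),
    mlieBracket_smul_right' hfY hZ, mlieBracket_smul_right' hfX hZ,
    mlieBracket_smul_right' hf (hY.mlieBracket hZ),
    mlieBracket_smul_right' hf (hX.mlieBracket hZ), J0] at J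
  have hJ : (dirDeriv f x (mlieBracket 𝓘(ℝ, E) X Y x)
      - (dirDeriv (fun y ↦ dirDeriv f y (Y y)) x (X x)
        - dirDeriv (fun y ↦ dirDeriv f y (X y)) x (Y x))) • Z x = 0 := by
    rw [← sub_eq_zero] at J
    rw [← neg_eq_zero, ← J]
    module
  rcases smul_eq_zero.1 hJ with h | h
  · exact sub_eq_zero.1 h
  · exact absurd (hZx.symm.trans h) hv

/-- Smooth functions separate tangent vectors. -/
lemma eq_zero_of_dirDeriv_eq_zero {x : M} {v : TangentSpace 𝓘(ℝ, E) x}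
    (h : ∀ f : M → ℝ, SmoothFn (E := E) f → dirDeriv f x v = 0) : v = 0 := by
  let φ := extChartAt 𝓘(ℝ, E) x
  have hφ : MDifferentiableAt 𝓘(ℝ, E) 𝓘(ℝ, E) φ x :=
    mdifferentiableAt_extChartAt (mem_chart_source E x)
  have key : mfderiv 𝓘(ℝ, E) 𝓘(ℝ, E) φ x v = (0 : E) := by
    by_contra hne
    -- The separating function is a linear functional of the chart, cut off by a bump.
    obtain ⟨l, hl⟩ := SeparatingDual.exists_ne_zero (R := ℝ) (V := E) hne
    obtain ⟨χ⟩ : Nonempty (SmoothBumpFunction 𝓘(ℝ, E) x) := inferInstance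
    have hs : SmoothFn (E := E) (fun y ↦ χ y • l (φ y)) :=
      χ.contMDiff_smul (l.contMDiff.comp_contMDiffOn contMDiffOn_extChartAt)
    apply hl
    have h1 : (fun y ↦ χ y • l (φ y)) =ᶠ[𝓝 x] fun y ↦ l (φ y) := by
      filter_upwards [χ.eventuallyEq_one] with y hy using by simp [hy]
    have h2 := h _ hs
    rw [dirDeriv_congr h1] at h2
    rw [← h2]
    have h3 := (l.hasMFDerivAt (x := φ x)).comp x hφ.hasMFDerivAt
    exact (congrArg (fun l : E →L[ℝ] ℝ ↦ l v) h3.mfderiv).symm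
  obtain ⟨e, he⟩ := isInvertible_mfderiv_extChartAt (I := 𝓘(ℝ, E)) (mem_extChartAt_source x)
  refine (map_eq_zero_iff e e.injective).1 (Eq.trans ?_ key)
  exact congrArg (fun l : E →L[ℝ] E ↦ l v) he

end Bump

/-! ### From operators on smooth vector fields to linear connections. -/

section Builder

variable {E : Type*} [NormedAddCommGroup E] [NormedSpace ℝ E]
  {M : Type*} [TopologicalSpace M] [ChartedSpace E M] [IsManifold 𝓘(ℝ, E) ∞ M]

/-- `B V W = ∇_V W` is an affine connection given as an operator on global smooth vector fields. -/
structure IsConnOp (B : VF E M → VF E M → VF E M) : Prop where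
  smooth : ∀ V W : VF E M, IsSmoothVF V → IsSmoothVF W → IsSmoothVF (B V W)
  add_left : ∀ V V' W : VF E M, IsSmoothVF V → IsSmoothVF V' → IsSmoothVF W →
    B (V + V') W = B V W + B V' W
  smul_left : ∀ (f : M → ℝ) (V W : VF E M), SmoothFn (E := E) f → IsSmoothVF V → IsSmoothVF W →
    B (f • V) W = f • B V W
  add_right : ∀ V W W' : VF E M, IsSmoothVF V → IsSmoothVF W → IsSmoothVF W' →
    B V (W + W') = B V W + B V W'
  leibniz : ∀ (f : M → ℝ) (V W : VF E M), SmoothFn (E := E) f → IsSmoothVF V → IsSmoothVF W →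
    B V (f • W) = (fun x ↦ dirDeriv f x (V x)) • W + f • B V W

namespace IsConnOp

variable {B : VF E M → VF E M → VF E M}

lemma sum_right (hB : IsConnOp B) {ι : Type*} (s : Finset ι) {f : ι → M → ℝ} {X : ι → VF E M}
    {V : VF E M} (hV : IsSmoothVF V) (hf : ∀ i, SmoothFn (E := E) (f i))
    (hX : ∀ i, IsSmoothVF (X i)) (x : M) :
    B V (fun y ↦ ∑ i ∈ s, f i y • X i y) x
      = ∑ i ∈ s, (dirDeriv (f i) x (V x) • X i x + f i x • B V (X i) x) := by
  classical
  induction s using Finset.induction_on with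
  | empty =>
    have h := hB.add_right V 0 0 hV isSmoothVF_zero isSmoothVF_zero
    have h0 : B V 0 = 0 := by simpa using h
    simpa using! congrFun h0 x
  | insert a s ha ih =>
    have e : (fun y ↦ ∑ i ∈ insert a s, f i y • X i y)
        = f a • X a + fun y ↦ ∑ i ∈ s, f i y • X i y := by
      funext y; simp [Finset.sum_insert ha]
    have hs : IsSmoothVF (fun y ↦ ∑ i ∈ s, f i y • X i y) :=
      IsSmoothVF.sum (X := fun i ↦ f i • X i) fun i _ ↦ (hX i).smul (hf i)
    rw [e, hB.add_right _ _ _ hV ((hX a).smul (hf a)) hs, hB.leibniz _ _ _ (hf a) hV (hX a),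
      Finset.sum_insert ha, Pi.add_apply, ih]
    rfl

lemma sum_left (hB : IsConnOp B) {ι : Type*} (s : Finset ι) {f : ι → M → ℝ} {X : ι → VF E M}
    {W : VF E M} (hW : IsSmoothVF W) (hf : ∀ i, SmoothFn (E := E) (f i))
    (hX : ∀ i, IsSmoothVF (X i)) (x : M) :
    B (fun y ↦ ∑ i ∈ s, f i y • X i y) W x = ∑ i ∈ s, f i x • B (X i) W x := by
  classical
  induction s using Finset.induction_on with
  | empty =>
    have h := hB.add_left 0 0 W isSmoothVF_zero isSmoothVF_zero hW
    have h0 : B 0 W = 0 := by simpa using h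
    simpa using! congrFun h0 x
  | insert a s ha ih =>
    have e : (fun y ↦ ∑ i ∈ insert a s, f i y • X i y)
        = f a • X a + fun y ↦ ∑ i ∈ s, f i y • X i y := by
      funext y; simp [Finset.sum_insert ha]
    have hs : IsSmoothVF (fun y ↦ ∑ i ∈ s, f i y • X i y) :=
      IsSmoothVF.sum (X := fun i ↦ f i • X i) fun i _ ↦ (hX i).smul (hf i)
    rw [e, hB.add_left _ _ _ ((hX a).smul (hf a)) hs hW, hB.smul_left _ _ _ (hf a) (hX a) hW,
      Finset.sum_insert ha, Pi.add_apply, ih]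
    rfl

end IsConnOp

omit [IsManifold 𝓘(ℝ, E) ∞ M] in
lemma SmoothFn.mul_of_tsupport {χ g : M → ℝ} {U : Set M} (hχ : SmoothFn (E := E) χ)
    (hU : IsOpen U) (ht : tsupport χ ⊆ U) (hg : ContMDiffOn 𝓘(ℝ, E) 𝓘(ℝ, ℝ) ∞ g U) :
    SmoothFn (E := E) (fun y ↦ χ y * g y) := by
  refine contMDiff_of_tsupport fun x hx ↦ ?_
  have hxU : x ∈ U := ht (closure_mono (Function.support_mul_subset_left χ g) hx)
  exact (hχ x).mul (hg.contMDiffAt (hU.mem_nhds hxU))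

omit [IsManifold 𝓘(ℝ, E) ∞ M] in
/-- Smoothness of a map into continuous linear maps is checked on a basis. -/
lemma contMDiffAt_clm_of_basis {ι F G : Type*} [Fintype ι] [NormedAddCommGroup F] [NormedSpace ℝ F]
    [FiniteDimensional ℝ F] [NormedAddCommGroup G] [NormedSpace ℝ G]
    (b : Module.Basis ι ℝ F) {f : M → F →L[ℝ] G} {x : M}
    (h : ∀ i, ContMDiffAt 𝓘(ℝ, E) 𝓘(ℝ, G) ∞ (fun y ↦ f y (b i)) x) :
    ContMDiffAt 𝓘(ℝ, E) 𝓘(ℝ, F →L[ℝ] G) ∞ f x := by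
  have e : f = fun y ↦ ∑ i, ContinuousLinearMap.smulRightL ℝ F G
      (LinearMap.toContinuousLinearMap (b.coord i)) (f y (b i)) := by
    funext y
    ext v
    conv_lhs => rw [← b.sum_repr v]
    simp only [map_sum, map_smul]
    simp
  rw [e]
  exact contMDiffAt_finsetSum fun i _ ↦
    (ContinuousLinearMap.contMDiff (𝕜 := ℝ) _).contMDiffAt.comp x (h i)

variable [FiniteDimensional ℝ E] [T2Space M]

variable (E) in
/-- A frame of smooth global vector fields near a point, together with its smooth global
coefficients. -/
lemma exists_frame (x : M) : ∃ (b : Fin (Module.finrank ℝ E) → VF E M)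
    (c : Fin (Module.finrank ℝ E) → ∀ y, TangentSpace 𝓘(ℝ, E) y →ₗ[ℝ] ℝ) (χ : M → ℝ),
    (∀ i, IsSmoothVF (b i)) ∧ SmoothFn (E := E) χ ∧ χ =ᶠ[𝓝 x] 1 ∧
    (∀ W : VF E M, IsSmoothVF W → ∀ i, SmoothFn (E := E) (fun y ↦ c i y (W y))) ∧
    (∀ W : VF E M, MDifferentiableAt 𝓘(ℝ, E) 𝓘(ℝ, E).tangent
      (fun x ↦ (⟨x, W x⟩ : TangentBundle 𝓘(ℝ, E) M)) x → ∀ i,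
        MDifferentiableAt 𝓘(ℝ, E) 𝓘(ℝ, ℝ) (fun y ↦ c i y (W y)) x) ∧
    (∀ y (v : TangentSpace 𝓘(ℝ, E) y), ∑ i, c i y v • b i y = χ y • v) := by
  let e := trivializationAt E (TangentSpace 𝓘(ℝ, E) : M → Type _) x
  have hx : x ∈ e.baseSet := FiberBundle.mem_baseSet_trivializationAt' x
  obtain ⟨χ, h1, h2, h3⟩ := exists_bump (E := E) (e.open_baseSet.mem_nhds hx)
  let β := Module.finBasis ℝ E
  -- Frame fields and coefficients are both cut off by χ to become global, so the cutoff in the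
  -- expansion formula is χ².
  refine ⟨fun i ↦ χ • e.localFrame β i, fun i y ↦ χ y • e.localFrameCoeff 𝓘(ℝ, E) β i y,
    fun y ↦ χ y * χ y, fun i ↦ ?_, h1.mul h1, ?_, fun W hW i ↦ ?_, fun W hW i ↦ ?_,
    fun y v ↦ ?_⟩
  · exact ContMDiffOn.smul_section_of_tsupport h1.contMDiffOn e.open_baseSet h3
      (e.contMDiffOn_localFrame_baseSet _ β i)
  · filter_upwards [h2] with y hy using by simp [hy]
  · exact SmoothFn.mul_of_tsupport h1 e.open_baseSet h3
      (contMDiffOn_baseSet_localFrameCoeff β (ContMDiff.contMDiffOn hW) i)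
  · exact (h1.mdiffAt x).mul (mdifferentiableAt_localFrameCoeff β hx hW i)
  · by_cases hy : y ∈ e.baseSet
    · have h := e.eq_sum_localFrameCoeff_smul (I := 𝓘(ℝ, E)) (b := β)
        (s := FiberBundle.extend E v) hy
      simp only [FiberBundle.extend_apply_self] at h
      conv_rhs => rw [h]
      simp only [Finset.smul_sum, LinearMap.smul_apply, Pi.smul_apply', smul_smul, smul_eq_mul]
      exact Finset.sum_congr rfl fun i _ ↦ by ring_nf
    · have h0 : χ y = 0 := image_eq_zero_of_notMem_tsupport fun h ↦ hy (h3 h)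
      simp [h0]

/-- An operator on global smooth vector fields with the algebraic properties of an affine
connection comes from a smooth linear connection. -/
theorem IsConnOp.exists_linConn {B : VF E M → VF E M → VF E M} (hB : IsConnOp B) :
    ∃ cov : LinConn E M, IsSmoothConn cov ∧
      ∀ V W : VF E M, IsSmoothVF V → IsSmoothVF W → ∀ x, cov W x (V x) = B V W x := by
  choose b c χ hb hχ hχ1 hc hc' hbc using exists_frame (M := M) E
  have hχx : ∀ x, χ x x = 1 := fun x ↦ (hχ1 x).self_of_nhds
  have hsum : ∀ x (W : VF E M), (fun y ↦ ∑ i, c x i y (W y) • b x i y) = χ x • W :=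
    fun x W ↦ funext fun y ↦ hbc x y (W y)
  have hdχ : ∀ x v, dirDeriv (E := E) (χ x) x v = 0 := fun x v ↦ by
    rw [dirDeriv_congr (hχ1 x)]; exact dirDeriv_const 1 x v
  -- the value of `B` in terms of the frame
  have hval : ∀ V W : VF E M, IsSmoothVF V → IsSmoothVF W → ∀ x, B V W x =
      ∑ i, (dirDeriv (fun y ↦ c x i y (W y)) x (V x) • b x i x
        + c x i x (W x) • ∑ j, c x j x (V x) • B (b x j) (b x i) x) := by
    intro V W hV hW x
    -- Locality: χ has value 1 and derivative 0 at x, so multiplying by it changes nothing there,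
    -- and χ • W is a global combination of the frame.
    have h1 : B V W x = B V (χ x • W) x := by
      rw [hB.leibniz _ _ _ (hχ x) hV hW]
      simp [hdχ, hχx]
    have h2 : ∀ i, B V (b x i) x = ∑ j, c x j x (V x) • B (b x j) (b x i) x := fun i ↦ by
      have : B V (b x i) x = B (χ x • V) (b x i) x := by
        rw [hB.smul_left _ _ _ (hχ x) hV (hb x i)]
        simp [hχx]
      rw [this, ← hsum, hB.sum_left _ (hb x i) (hc x V hV) (hb x)]
    rw [h1, ← hsum, hB.sum_right _ hV (hc x W hW) (hb x)]
    simp only [h2]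
  have hcont : ∀ x j, Continuous (c x j x) := fun x j ↦ by
    have : FiniteDimensional ℝ (TangentSpace 𝓘(ℝ, E) x) := inferInstanceAs (FiniteDimensional ℝ E)
    have : T2Space (TangentSpace 𝓘(ℝ, E) x) := inferInstanceAs (T2Space E)
    exact LinearMap.continuous_of_finiteDimensional _
  -- The right side of `hval`, with the frame centred at the point of evaluation. It makes sense for
  -- every W, and satisfies the axioms for fields merely differentiable at x, as a `LinConn` must.
  let F (W : VF E M) (x : M) : TangentSpace 𝓘(ℝ, E) x →L[ℝ] TangentSpace 𝓘(ℝ, E) x :=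
    ∑ i, ((mvfderiv 𝓘(ℝ, E) (fun y ↦ c x i y (W y)) x).smulRight (b x i x)
      + c x i x (W x) • ∑ j, (⟨c x j x, hcont x j⟩ :
          TangentSpace 𝓘(ℝ, E) x →L[ℝ] ℝ).smulRight (B (b x j) (b x i) x))
  have hF : ∀ (W : VF E M) x v, F W x v = ∑ i, (dirDeriv (fun y ↦ c x i y (W y)) x v • b x i x
        + c x i x (W x) • ∑ j, c x j x v • B (b x j) (b x i) x) := by
    intro W x v
    simp only [F, sum_apply, add_apply, smul_apply,
      ContinuousLinearMap.smulRight_apply]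
    rfl
  have hFB : ∀ V W : VF E M, IsSmoothVF V → IsSmoothVF W → ∀ x, F W x (V x) = B V W x :=
    fun V W hV hW x ↦ by rw [hF, hval V W hV hW]
  let cov : LinConn E M :=
    { toFun := F
      isCovariantDerivativeOnUniv :=
        { add := by
            intro σ σ' x hσ hσ' _
            ext v
            have h1 : ∀ i, dirDeriv (fun y ↦ c x i y ((σ + σ') y)) x v
                = dirDeriv (fun y ↦ c x i y (σ y)) x v + dirDeriv (fun y ↦ c x i y (σ' y)) x v := by
              intro i
              rw [← dirDeriv_add (hc' x σ hσ i) (hc' x σ' hσ' i)]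
              simp only [Pi.add_apply, map_add]
            rw [add_apply, hF, hF, hF, ← Finset.sum_add_distrib]
            refine Finset.sum_congr rfl fun i _ ↦ ?_
            rw [h1, Pi.add_apply, map_add]
            module
          leibniz := by
            intro σ g x hσ hg _
            ext v
            have h1 : ∀ i, dirDeriv (fun y ↦ c x i y ((g • σ) y)) x v
                = g x * dirDeriv (fun y ↦ c x i y (σ y)) x v + c x i x (σ x) * dirDeriv g x v := by
              intro i
              rw [← dirDeriv_mul hg (hc' x σ hσ i)]
              simp only [Pi.smul_apply', map_smul, smul_eq_mul]
            have h2 : σ x = ∑ i, c x i x (σ x) • b x i x := by rw [hbc, hχx, one_smul]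
            have h3 : (g x • F σ x + (mvfderiv 𝓘(ℝ, E) g x).smulRight (σ x)) v
                = g x • F σ x v + dirDeriv g x v • ∑ i, c x i x (σ x) • b x i x := by
              rw [← h2]; rfl
            rw [h3, hF, hF, Finset.smul_sum, Finset.smul_sum, ← Finset.sum_add_distrib]
            refine Finset.sum_congr rfl fun i _ ↦ ?_
            rw [h1, Pi.smul_apply', map_smul, smul_eq_mul]
            module } }
  refine ⟨cov, ⟨⟨fun {σ} hσ ↦ ?_⟩⟩, hFB⟩
  have hσ' : IsSmoothVF σ := contMDiffOn_univ.1 hσ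
  rw [contMDiffOn_univ]
  intro x
  rw [contMDiffAt_hom_bundle]
  refine ⟨contMDiffAt_id, contMDiffAt_clm_of_basis (Module.finBasis ℝ E) fun i ↦ ?_⟩
  let e := trivializationAt E (TangentSpace 𝓘(ℝ, E) : M → Type _) x
  have hx : x ∈ e.baseSet := FiberBundle.mem_baseSet_trivializationAt' x
  obtain ⟨ψ, hψ, hψ1, hψ0, hψs⟩ := exists_bump_smul (E := E) e.open_baseSet hx
  -- Near x the cutoff is 1, so in the trivialization the i-th component of the covariant derivative
  -- is `B` applied to this smooth field.
  have hX := hψs _ (e.contMDiffOn_localFrame_baseSet ∞ (Module.finBasis ℝ E) i)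
  have hBX := (Bundle.contMDiffAt_section (IB := 𝓘(ℝ, E)) (n := ∞) (F := E)
    (E := (TangentSpace 𝓘(ℝ, E) : M → Type _)) _).1 (hB.smooth _ σ hX hσ' x)
  refine hBX.congr_of_eventuallyEq ?_
  filter_upwards [hψ1, e.open_baseSet.mem_nhds hx] with y hy hye
  rw [← hFB _ _ hX hσ']
  have hy' : ψ y = 1 := hy
  rw [ContinuousLinearMap.inCoordinates_eq hye hye]
  simp only [Pi.smul_apply', hy', one_smul, e.localFrame_apply_of_mem_baseSet _ hye]
  have hb' : e.basisAt (Module.finBasis ℝ E) hye i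
      = (e.continuousLinearEquivAt ℝ y hye).symm (Module.finBasis ℝ E i) := by
    simp only [Bundle.Trivialization.basisAt, Module.Basis.map_apply]
    rfl
  rw [hb']
  rfl

end Builder

/-! ### Smooth dependence of inverse matrices. -/

section SmoothMatrix

variable {E : Type*} [NormedAddCommGroup E] [NormedSpace ℝ E]
  {M : Type*} [TopologicalSpace M] [ChartedSpace E M]
  {ι : Type*} [Fintype ι] [DecidableEq ι]

lemma contMDiffAt_det {A : M → Matrix ι ι ℝ} {x : M}
    (hA : ∀ i j, ContMDiffAt 𝓘(ℝ, E) 𝓘(ℝ, ℝ) ∞ (fun y ↦ A y i j) x) :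
    ContMDiffAt 𝓘(ℝ, E) 𝓘(ℝ, ℝ) ∞ (fun y ↦ (A y).det) x := by
  simp only [Matrix.det_apply']
  exact contMDiffAt_finsetSum fun σ _ ↦ contMDiffAt_const.mul
    (contMDiffAt_finsetProd fun i _ ↦ hA _ _)

/-- Cramer's rule: the entries of the inverse are quotients of determinants in the entries. -/
lemma contMDiffAt_matrix_inv {A : M → Matrix ι ι ℝ} {x : M}
    (hA : ∀ i j, ContMDiffAt 𝓘(ℝ, E) 𝓘(ℝ, ℝ) ∞ (fun y ↦ A y i j) x) (hx : (A x).det ≠ 0)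
    (i j : ι) : ContMDiffAt 𝓘(ℝ, E) 𝓘(ℝ, ℝ) ∞ (fun y ↦ (A y)⁻¹ i j) x := by
  simp only [Matrix.inv_def, Ring.inverse_eq_inv', Matrix.smul_apply, smul_eq_mul,
    Matrix.adjugate_apply]
  refine ((contMDiffAt_det hA).inv₀ hx).mul (contMDiffAt_det fun a b ↦ ?_)
  by_cases h : a = j
  · subst h; simpa using contMDiffAt_const
  · simpa [Matrix.updateRow_ne h] using hA a b

end SmoothMatrix

/-! ### Gluing local solutions, and one-forms on a distribution. -/

section Gluing

variable {E : Type*} [NormedAddCommGroup E] [NormedSpace ℝ E]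
  {M : Type*} [TopologicalSpace M] [ChartedSpace E M] [IsManifold 𝓘(ℝ, E) ∞ M]

lemma isSmoothVF_of_eventuallyEq {U : VF E M}
    (h : ∀ x₀, ∃ U' : VF E M, IsSmoothVF U' ∧ ∀ᶠ x in 𝓝 x₀, U x = U' x) : IsSmoothVF U := by
  intro x₀
  obtain ⟨U', hU', he⟩ := h x₀
  refine (hU' x₀).congr_of_eventuallyEq ?_
  filter_upwards [he] with x hx
  rw [hx]

/-- Pointwise uniqueness makes the local solutions agree on overlaps, so no partition of unity is
needed. -/
lemma exists_smoothVF_of_unique {P : ∀ x : M, TangentSpace 𝓘(ℝ, E) x → Prop}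
    (huniq : ∀ x v w, P x v → P x w → v = w)
    (h : ∀ x₀, ∃ U : VF E M, IsSmoothVF U ∧ ∀ᶠ x in 𝓝 x₀, P x (U x)) :
    ∃ U : VF E M, IsSmoothVF U ∧ ∀ x, P x (U x) := by
  choose V hV hP using h
  refine ⟨fun x ↦ V x x, isSmoothVF_of_eventuallyEq fun x₀ ↦ ⟨V x₀, hV x₀, ?_⟩,
    fun x ↦ (hP x).self_of_nhds⟩
  filter_upwards [hP x₀] with x hx using huniq x _ _ (hP x).self_of_nhds hx

/-- `φ` is a smooth `1`-form on the distribution `D`, given as a function of sections of `D`. -/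
structure IsFormOn (D : Distr E M) (φ : VF E M → M → ℝ) : Prop where
  smooth : ∀ X, IsSection D X → SmoothFn (E := E) (φ X)
  add : ∀ X Y, IsSection D X → IsSection D Y → ∀ x, φ (X + Y) x = φ X x + φ Y x
  smul : ∀ (f : M → ℝ) X, SmoothFn (E := E) f → IsSection D X → ∀ x, φ (f • X) x = f x * φ X x

lemma IsSection.add {D : Distr E M} {X Y : VF E M} (hX : IsSection D X) (hY : IsSection D Y) :
    IsSection D (X + Y) := ⟨hX.1.add hY.1, fun x ↦ (D x).add_mem (hX.2 x) (hY.2 x)⟩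

lemma IsSection.smul {D : Distr E M} {f : M → ℝ} {X : VF E M} (hf : SmoothFn (E := E) f)
    (hX : IsSection D X) : IsSection D (f • X) :=
  ⟨hX.1.smul hf, fun x ↦ (D x).smul_mem _ (hX.2 x)⟩

lemma isSection_zero (D : Distr E M) : IsSection D 0 :=
  ⟨isSmoothVF_zero, fun x ↦ (D x).zero_mem⟩

lemma IsSection.sum {ι : Type*} {s : Finset ι} {D : Distr E M} {X : ι → VF E M}
    (hX : ∀ i ∈ s, IsSection D (X i)) : IsSection D (fun x ↦ ∑ i ∈ s, X i x) :=
  ⟨IsSmoothVF.sum fun i hi ↦ (hX i hi).1, fun x ↦ (D x).sum_mem fun i hi ↦ (hX i hi).2 x⟩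

lemma IsFormOn.sum {D : Distr E M} {φ : VF E M → M → ℝ} (hφ : IsFormOn D φ) {ι : Type*}
    (s : Finset ι) {f : ι → M → ℝ} {X : ι → VF E M} (hf : ∀ i, SmoothFn (E := E) (f i))
    (hX : ∀ i, IsSection D (X i)) (x : M) :
    φ (fun y ↦ ∑ i ∈ s, f i y • X i y) x = ∑ i ∈ s, f i x * φ (X i) x := by
  classical
  induction s using Finset.induction_on with
  | empty =>
    have h := hφ.add 0 0 (isSection_zero D) (isSection_zero D) x
    rw [add_zero, left_eq_add] at h
    simpa using! h
  | insert a s ha ih =>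
    have e : (fun y ↦ ∑ i ∈ insert a s, f i y • X i y)
        = f a • X a + fun y ↦ ∑ i ∈ s, f i y • X i y := by
      funext y; simp [Finset.sum_insert ha]
    have hs : IsSection D (fun y ↦ ∑ i ∈ s, f i y • X i y) :=
      IsSection.sum (X := fun i ↦ f i • X i) fun i _ ↦ (hX i).smul (hf i)
    rw [e, hφ.add _ _ ((hX a).smul (hf a)) hs,
      hφ.smul _ _ (hf a) (hX a), Finset.sum_insert ha, ih]

variable [FiniteDimensional ℝ E] [T2Space M]

/-- Function-linearity makes φ local: multiplying by a bump equal to 1 at x turns the expansion near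
x into a global one. -/
lemma IsFormOn.eq_sum {D : Distr E M} {φ : VF E M → M → ℝ} (hφ : IsFormOn D φ) {ι : Type*}
    {s : Finset ι} {f : ι → M → ℝ} {X : ι → VF E M} {Y : VF E M}
    (hf : ∀ i, SmoothFn (E := E) (f i))
    (hX : ∀ i, IsSection D (X i)) (hY : IsSection D Y) {x : M}
    (h : ∀ᶠ y in 𝓝 x, Y y = ∑ i ∈ s, f i y • X i y) :
    φ Y x = ∑ i ∈ s, f i x * φ (X i) x := by
  obtain ⟨χ, hχ, hχ1, hχs⟩ := exists_bump (E := E) h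
  have hχx : χ x = 1 := hχ1.self_of_nhds
  have e : χ • Y = fun y ↦ ∑ i ∈ s, (χ y * f i y) • X i y := by
    funext y
    by_cases hy : y ∈ tsupport χ
    · have : Y y = ∑ i ∈ s, f i y • X i y := hχs hy
      simp only [Pi.smul_apply', this, Finset.smul_sum, smul_smul]
    · simp [image_eq_zero_of_notMem_tsupport hy]
  have h1 : φ Y x = φ (χ • Y) x := by rw [hφ.smul _ _ hχ hY, hχx, one_mul]
  rw [h1, e, hφ.sum s (f := fun i y ↦ χ y * f i y) (fun i ↦ hχ.mul (hf i)) hX]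
  simp [hχx]

end Gluing

/-! ### Linear algebra of a k-symplectic structure, and adapted frames. -/

section Frames

variable {E : Type*} [NormedAddCommGroup E] [NormedSpace ℝ E]
  {M : Type*} [TopologicalSpace M] [ChartedSpace E M] [IsManifold 𝓘(ℝ, E) ∞ M]
  {n k : ℕ} {Ω : Fin k → BilinField E M} {L Q : Distr E M}

omit [IsManifold 𝓘(ℝ, E) ∞ M] in
lemma mem_subL_iff {α : Fin k} {x : M} {v : TangentSpace 𝓘(ℝ, E) x} :
    v ∈ subL Ω L α x ↔ v ∈ L x ∧ ∀ β, β ≠ α → ∀ w, Ω β x v w = 0 := by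
  simp only [subL, charSpace, Submodule.mem_inf, Submodule.mem_iInf, LinearMap.mem_ker]
  refine and_congr_right fun _ ↦ forall_congr' fun β ↦ forall_congr' fun _ ↦ ?_
  exact ⟨fun h w ↦ congrArg (fun l : TangentSpace 𝓘(ℝ, E) x →L[ℝ] ℝ ↦ l w) h,
    fun h ↦ ContinuousLinearMap.ext h⟩

lemma IsSection.of_subL {α : Fin k} {X : VF E M} (hX : IsSection (subL Ω L α) X) :
    IsSection L X := ⟨hX.1, fun x ↦ (mem_subL_iff.1 (hX.2 x)).1⟩

lemma IsAdmissible.exists_add (hQ : IsAdmissible n Ω L Q) (x : M) (v : TangentSpace 𝓘(ℝ, E) x) :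
    ∃ l ∈ L x, ∃ q ∈ Q x, l + q = v :=
  Submodule.mem_sup.1 (((hQ.transversal x).sup_eq_top).symm ▸ Submodule.mem_top)

variable (hM : IsKSymplectic n k Ω L) (hQ : IsAdmissible n Ω L Q)
include hM hQ

lemma form_eq_zero_of_mem_L {α : Fin k} {x : M} {v : TangentSpace 𝓘(ℝ, E) x} (hv : v ∈ L x)
    (h : ∀ w ∈ Q x, Ω α x v w = 0) (w : TangentSpace 𝓘(ℝ, E) x) : Ω α x v w = 0 := by
  obtain ⟨l, hl, q, hq, rfl⟩ := hQ.exists_add x w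
  rw [map_add, hM.isotropic α x v hv l hl, h q hq, add_zero]

/-- As L is isotropic, pairing with Q is the same as pairing with the whole tangent space, and
nondegeneracy applies. -/
lemma eq_zero_of_mem_L {x : M} {v : TangentSpace 𝓘(ℝ, E) x} (hv : v ∈ L x)
    (h : ∀ α, ∀ w ∈ Q x, Ω α x v w = 0) : v = 0 := by
  have : v ∈ ⨅ α, charSpace (Ω α) x := by
    simp only [charSpace, Submodule.mem_iInf, LinearMap.mem_ker]
    exact fun α ↦ ContinuousLinearMap.ext fun w ↦ form_eq_zero_of_mem_L hM hQ hv (h α) w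
  rwa [hM.nondegenerate, Submodule.mem_bot] at this

lemma eq_of_mem_L {x : M} {v v' : TangentSpace 𝓘(ℝ, E) x} (hv : v ∈ L x) (hv' : v' ∈ L x)
    (h : ∀ α, ∀ w ∈ Q x, Ω α x v w = Ω α x v' w) : v = v' := by
  refine sub_eq_zero.1 (eq_zero_of_mem_L hM hQ ((L x).sub_mem hv hv') fun α w hw ↦ ?_)
  rw [map_sub, sub_apply, h α w hw, sub_self]

lemma mem_subL_of_forall {α : Fin k} {x : M} {v : TangentSpace 𝓘(ℝ, E) x} (hv : v ∈ L x)
    (h : ∀ β, β ≠ α → ∀ w ∈ Q x, Ω β x v w = 0) : v ∈ subL Ω L α x :=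
  mem_subL_iff.2 ⟨hv, fun β hβ ↦ form_eq_zero_of_mem_L hM hQ hv (h β hβ)⟩

end Frames

section AdaptedFrames

variable {E : Type*} [NormedAddCommGroup E] [NormedSpace ℝ E] [FiniteDimensional ℝ E]
  {M : Type*} [TopologicalSpace M] [T2Space M] [ChartedSpace E M] [IsManifold 𝓘(ℝ, E) ∞ M]
  {n k : ℕ} {Ω : Fin k → BilinField E M} {L Q : Distr E M}
  (hM : IsKSymplectic n k Ω L) (hQ : IsAdmissible n Ω L Q)
include hM hQ

/-- Near every point, `Q` has a frame `q` and every `L_α` has a frame `e α` dual to `q`. -/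
lemma exists_adapted_frame (x₀ : M) : ∃ (q : Fin n → VF E M) (e : Fin k → Fin n → VF E M),
    (∀ i, IsSection Q (q i)) ∧ (∀ α i, IsSection (subL Ω L α) (e α i)) ∧
    ∀ᶠ y in 𝓝 x₀, (∀ v ∈ Q y, v ∈ Submodule.span ℝ (Set.range fun i ↦ q i y)) ∧
      ∀ α β i j, Ω β y (e α i y) (q j y) = if α = β ∧ i = j then 1 else 0 := by
  obtain ⟨U₁, hU₁, hx₁, s, hs, hsQ⟩ := hQ.foliation.smooth x₀
  obtain ⟨U₂, hU₂, hx₂, l, hl, hlL⟩ := hM.foliation.smooth x₀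
  have hU := hU₁.inter hU₂
  -- L has rank n k, and k forms paired with n fields of Q give as many equations, so the pairing
  -- matrix is square. A kernel vector would be an element of L paired to 0 with Q by every form,
  -- hence 0.
  let σ : Fin k × Fin n ≃ Fin (n * k) := finProdFinEquiv.trans (finCongr (mul_comm k n))
  let A : M → Matrix (Fin k × Fin n) (Fin k × Fin n) ℝ := fun y b a ↦
    Ω b.1 y (l (σ a) y) (s b.2 y)
  have hdet : ∀ y ∈ U₁ ∩ U₂, (A y).det ≠ 0 := by
    intro y hy h0
    obtain ⟨c, hc, hc0⟩ := Matrix.exists_mulVec_eq_zero_iff.2 h0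
    let v : TangentSpace 𝓘(ℝ, E) y := ∑ a, c a • l (σ a) y
    have hvL : v ∈ L y := Submodule.sum_mem _ fun a _ ↦ Submodule.smul_mem _ _ (by
      rw [← (hlL y hy.2).2]; exact Submodule.subset_span ⟨_, rfl⟩)
    have hv0 : v = 0 := by
      refine eq_zero_of_mem_L hM hQ hvL fun α w hw ↦ ?_
      rw [← (hsQ y hy.1).2] at hw
      induction hw using Submodule.span_induction with
      | mem w hw =>
        obtain ⟨j, rfl⟩ := hw
        have := congrFun hc0 (α, j)
        simp only [v, map_sum, map_smul, sum_apply, smul_apply, smul_eq_mul]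
        simpa [Matrix.mulVec, dotProduct, A, mul_comm] using this
      | zero => exact map_zero _
      | add w w' _ _ h h' => rw [map_add, h, h', add_zero]
      | smul t w _ h => rw [map_smul, h, smul_zero]
    have hli := (hlL y hy.2).1.comp σ σ.injective
    rw [Fintype.linearIndependent_iff] at hli
    exact hc (funext (hli c hv0))
  have hA : ∀ y ∈ U₁ ∩ U₂, ∀ b a, ContMDiffAt 𝓘(ℝ, E) 𝓘(ℝ, ℝ) ∞ (fun y ↦ A y b a) y := by
    intro y hy b a
    have := ContMDiffAt.clm_bundle_apply₂ (F₁ := E) (F₂ := E) (F₃ := ℝ)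
      (E₁ := fun x : M ↦ TangentSpace 𝓘(ℝ, E) x) (E₂ := fun x : M ↦ TangentSpace 𝓘(ℝ, E) x)
      (E₃ := Bundle.Trivial M ℝ) (b := fun x ↦ x)
      (ψ := Ω b.1) (v := l (σ a)) (w := s b.2) ((hM.form b.1).smooth y)
      ((hl (σ a)).contMDiffAt (hU₂.mem_nhds hy.2)) ((hs b.2).contMDiffAt (hU₁.mem_nhds hy.1))
    exact (Bundle.contMDiffAt_section _).1 this
  -- The columns of the inverse matrix express the dual frame in the frame `l`.
  let e₀ (α : Fin k) (i : Fin n) : VF E M := fun y ↦ ∑ a, (A y)⁻¹ a (α, i) • l (σ a) y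
  have he₀ : ∀ α i, ContMDiffOn 𝓘(ℝ, E) 𝓘(ℝ, E).tangent ∞
      (fun x ↦ (⟨x, e₀ α i x⟩ : TangentBundle 𝓘(ℝ, E) M)) (U₁ ∩ U₂) := by
    intro α i
    refine ContMDiffOn.sum_section fun a _ ↦ ?_
    refine ContMDiffOn.smul_section (f := fun y ↦ (A y)⁻¹ a (α, i)) (fun y hy ↦ ?_)
      ((hl (σ a)).mono Set.inter_subset_right)
    exact (contMDiffAt_matrix_inv (hA y hy) (hdet y hy) a (α, i)).contMDiffWithinAt
  have hdual : ∀ y ∈ U₁ ∩ U₂, ∀ α β i j,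
      Ω β y (e₀ α i y) (s j y) = if α = β ∧ i = j then 1 else 0 := by
    intro y hy α β i j
    have h := congrFun (congrFun (Matrix.mul_nonsing_inv (A y)
      (isUnit_iff_ne_zero.2 (hdet y hy))) (β, j)) (α, i)
    simp only [Matrix.mul_apply, Matrix.one_apply, Prod.mk.injEq] at h
    simp only [e₀, map_sum, map_smul, sum_apply, smul_apply, smul_eq_mul]
    simp only [mul_comm, A] at h ⊢
    rw [h]
    simp only [eq_comm]
  have he₀L : ∀ y ∈ U₁ ∩ U₂, ∀ α i, e₀ α i y ∈ subL Ω L α y := by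
    intro y hy α i
    refine mem_subL_of_forall hM hQ (Submodule.sum_mem _ fun a _ ↦ Submodule.smul_mem _ _ (by
      rw [← (hlL y hy.2).2]; exact Submodule.subset_span ⟨_, rfl⟩)) fun β hβ w hw ↦ ?_
    rw [← (hsQ y hy.1).2] at hw
    induction hw using Submodule.span_induction with
    | mem w hw =>
      obtain ⟨j, rfl⟩ := hw
      rw [hdual y hy, if_neg fun h ↦ hβ h.1.symm]
    | zero => exact map_zero _
    | add w w' _ _ h h' => rw [map_add, h, h', add_zero]
    | smul t w _ h => rw [map_smul, h, smul_zero]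
  obtain ⟨χ, -, hχ1, hχ0, hχs⟩ := exists_bump_smul (E := E) hU ⟨hx₁, hx₂⟩
  refine ⟨fun i ↦ χ • s i, fun α i ↦ χ • e₀ α i,
    fun i ↦ ⟨hχs _ ((hs i).mono Set.inter_subset_left), fun y ↦ ?_⟩,
    fun α i ↦ ⟨hχs _ (he₀ α i), fun y ↦ ?_⟩, ?_⟩
  · by_cases hy : y ∈ U₁ ∩ U₂
    · exact Submodule.smul_mem _ _ (by
        rw [← (hsQ y hy.1).2]; exact Submodule.subset_span ⟨_, rfl⟩)
    · simp [hχ0 y hy]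
  · by_cases hy : y ∈ U₁ ∩ U₂
    · exact Submodule.smul_mem _ _ (he₀L y hy α i)
    · simp [hχ0 y hy]
  · filter_upwards [hχ1, hU.mem_nhds ⟨hx₁, hx₂⟩] with y hy hyU
    have hy' : χ y = 1 := hy
    simp only [Pi.smul_apply', hy', one_smul]
    exact ⟨fun v hv ↦ by rwa [(hsQ y hyU.1).2], hdual y hyU⟩

end AdaptedFrames

/-! ### Projections along the splitting TM = L ⊕ Q. -/

section Projections

variable {E : Type*} [NormedAddCommGroup E] [NormedSpace ℝ E]
  {M : Type*} [TopologicalSpace M] [ChartedSpace E M]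

/-- The part of the vector field `V` in `L`, along `Q`. -/
def proj {L Q : Distr E M} (h : ∀ x, IsCompl (L x) (Q x)) (V : VF E M) : VF E M := fun x ↦
  ((L x).projectionOnto (Q x) (h x) (V x) : TangentSpace 𝓘(ℝ, E) x)

variable {L Q : Distr E M} (h : ∀ x, IsCompl (L x) (Q x))

lemma proj_mem (V : VF E M) (x : M) : proj h V x ∈ L x :=
  ((L x).projectionOnto (Q x) (h x) (V x)).2

lemma proj_eq {V : VF E M} {x : M} {l q : TangentSpace 𝓘(ℝ, E) x} (hl : l ∈ L x) (hq : q ∈ Q x)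
    (hV : V x = l + q) : proj h V x = l := by
  rw [proj, hV, map_add]
  have h1 := Submodule.projectionOnto_apply_left (h x) ⟨l, hl⟩
  have h2 := (Submodule.projectionOnto_apply_eq_zero_iff (h x) (x := q)).2 hq
  simp only at h1
  rw [h1, h2, add_zero]

lemma proj_eq_self {V : VF E M} {x : M} (hV : V x ∈ L x) : proj h V x = V x :=
  proj_eq h hV (Q x).zero_mem (add_zero _).symm

lemma proj_eq_zero {V : VF E M} {x : M} (hV : V x ∈ Q x) : proj h V x = 0 :=
  proj_eq h (L x).zero_mem hV (zero_add _).symm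

lemma proj_add_proj (V : VF E M) (x : M) : proj h V x + proj (fun x ↦ (h x).symm) V x = V x := by
  obtain ⟨l, hl, q, hq, hlq⟩ : ∃ l ∈ L x, ∃ q ∈ Q x, l + q = V x :=
    Submodule.mem_sup.1 (((h x).sup_eq_top).symm ▸ Submodule.mem_top)
  rw [proj_eq h hl hq hlq.symm, proj_eq _ hq hl (by rw [add_comm, hlq]), hlq]

lemma proj_add (V W : VF E M) : proj h (V + W) = proj h V + proj h W := by
  funext x; simp [proj]

lemma proj_smul (f : M → ℝ) (V : VF E M) : proj h (f • V) = f • proj h V := by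
  funext x; simp [proj]

end Projections

/-! ### Representing one-forms by sections of L and of Q. -/

section Representation

variable {E : Type*} [NormedAddCommGroup E] [NormedSpace ℝ E] [FiniteDimensional ℝ E]
  {M : Type*} [TopologicalSpace M] [T2Space M] [ChartedSpace E M] [IsManifold 𝓘(ℝ, E) ∞ M]
  {n k : ℕ} {Ω : Fin k → BilinField E M} {L Q : Distr E M}
  (hM : IsKSymplectic n k Ω L) (hQ : IsAdmissible n Ω L Q)
include hM hQ

/-- Smoothness holds because in an adapted frame the L-part of V has the smooth coefficients Ω_α(V,
q_i): the Q-part of V pairs to 0 with Q. -/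
lemma IsSection.proj_L {V : VF E M} (hV : IsSmoothVF V) : IsSection L (proj hQ.transversal V) := by
  refine ⟨isSmoothVF_of_eventuallyEq fun x₀ ↦ ?_, proj_mem _ V⟩
  obtain ⟨q, e, hq, he, hqe⟩ := exists_adapted_frame hM hQ x₀
  refine ⟨fun y ↦ ∑ α, ∑ i, Ω α y (V y) (q i y) • e α i y, ?_, ?_⟩
  · exact IsSmoothVF.sum fun α _ ↦ IsSmoothVF.sum
      (X := fun i ↦ (fun y ↦ Ω α y (V y) (q i y)) • e α i) fun i _ ↦
        (he α i).1.smul ((hM.form α).smoothFn hV (hq i).1)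
  · filter_upwards [hqe] with y hy
    refine eq_of_mem_L hM hQ (proj_mem _ V y) (Submodule.sum_mem _ fun α _ ↦
      Submodule.sum_mem _ fun i _ ↦ Submodule.smul_mem _ _ ((he α i).of_subL.2 y)) fun β w hw ↦ ?_
    have hVw : ∀ w ∈ Q y, Ω β y (proj hQ.transversal V y) w = Ω β y (V y) w := fun w hw ↦ by
      conv_rhs => rw [← proj_add_proj hQ.transversal V y]
      rw [map_add, add_apply, hQ.isotropic β y _ (proj_mem _ V y) w hw, add_zero]
    have hw' := hy.1 w hw
    rw [hVw w hw]
    clear hw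
    induction hw' using Submodule.span_induction with
    | mem w hw =>
      obtain ⟨j, rfl⟩ := hw
      simp only [map_sum, map_smul, sum_apply, smul_apply, smul_eq_mul, hy.2]
      simp [ite_and]
    | zero => simp only [map_zero]
    | add w w' _ _ h h' => rw [map_add, map_add, h, h']
    | smul t w _ h => rw [map_smul, map_smul, h]

lemma IsSection.proj_Q {V : VF E M} (hV : IsSmoothVF V) :
    IsSection Q (proj (fun x ↦ (hQ.transversal x).symm) V) := by
  refine ⟨?_, proj_mem _ V⟩
  have e : proj (fun x ↦ (hQ.transversal x).symm) V = V - proj hQ.transversal V :=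
    funext fun x ↦ eq_sub_of_add_eq' (proj_add_proj hQ.transversal V x)
  rw [e]
  exact hV.sub (IsSection.proj_L hM hQ hV).1

/-- The forms Ω_α together identify L with k copies of the dual of Q. The section is Σ φ_α(q_i) e_{α
i} locally. -/
lemma exists_section_L_of_formOn {φ : Fin k → VF E M → M → ℝ} (hφ : ∀ α, IsFormOn Q (φ α)) :
    ∃ U : VF E M, IsSection L U ∧ ∀ α Y, IsSection Q Y → ∀ x, Ω α x (U x) (Y x) = φ α Y x := by
  let P : ∀ x : M, TangentSpace 𝓘(ℝ, E) x → Prop := fun x v ↦ v ∈ L x ∧ ∀ α Y, IsSection Q Y →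
    Ω α x v (Y x) = φ α Y x
  have huniq : ∀ x v w, P x v → P x w → v = w := by
    rintro x v w ⟨hv, hv'⟩ ⟨hw, hw'⟩
    refine eq_of_mem_L hM hQ hv hw fun α u hu ↦ ?_
    obtain ⟨Y, hY, rfl⟩ := hQ.foliation.smooth.exists_section x hu
    rw [hv' α Y hY, hw' α Y hY]
  have hloc : ∀ x₀, ∃ U : VF E M, IsSmoothVF U ∧ ∀ᶠ x in 𝓝 x₀, P x (U x) := by
    intro x₀
    obtain ⟨q, e, hq, he, hqe⟩ := exists_adapted_frame hM hQ x₀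
    refine ⟨fun y ↦ ∑ α, ∑ i, φ α (q i) y • e α i y, ?_, ?_⟩
    · exact IsSmoothVF.sum fun α _ ↦ IsSmoothVF.sum
        (X := fun i ↦ (φ α (q i)) • e α i) fun i _ ↦ (he α i).1.smul ((hφ α).smooth _ (hq i))
    · filter_upwards [hqe.eventually_nhds] with y hy
      refine ⟨Submodule.sum_mem _ fun α _ ↦ Submodule.sum_mem _ fun i _ ↦
        Submodule.smul_mem _ _ ((he α i).of_subL.2 y), fun β Y hY ↦ ?_⟩
      -- The expansion of Y in the frame must hold on a neighbourhood, since φ is only known on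
      -- sections.
      have hY' : ∀ᶠ z in 𝓝 y, Y z = ∑ i, Ω β z (e β i z) (Y z) • q i z := by
        filter_upwards [hy] with z hz
        obtain ⟨c, hc⟩ := (Submodule.mem_span_range_iff_exists_fun ℝ).1 (hz.1 _ (hY.2 z))
        rw [← hc]
        simp only [map_sum, map_smul, smul_eq_mul, hz.2]
        simp
      rw [(hφ β).eq_sum (fun i ↦ (hM.form β).smoothFn (he β i).1 hY.1) hq hY hY',
        hY'.self_of_nhds]
      simp only [map_sum, map_smul, sum_apply, smul_apply, smul_eq_mul, hy.self_of_nhds.2]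
      simp [ite_and, mul_comm]
  obtain ⟨U, hU, hP⟩ := exists_smoothVF_of_unique huniq hloc
  exact ⟨U, ⟨hU, fun x ↦ (hP x).1⟩, fun α Y hY x ↦ (hP x).2 α Y hY⟩

/-- One form suffices here: pairing with e_{α i} by Ω_α reads off, up to sign, the coefficient of
q_i. -/
lemma eq_zero_of_mem_Q (α : Fin k) {x : M} {v : TangentSpace 𝓘(ℝ, E) x} (hv : v ∈ Q x)
    (h : ∀ w ∈ subL Ω L α x, Ω α x v w = 0) : v = 0 := by
  obtain ⟨q, e, hq, he, hqe⟩ := exists_adapted_frame hM hQ x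
  obtain ⟨hs, hd⟩ := hqe.self_of_nhds
  obtain ⟨c, rfl⟩ := (Submodule.mem_span_range_iff_exists_fun ℝ).1 (hs _ hv)
  refine Finset.sum_eq_zero fun i _ ↦ ?_
  have h1 := h _ ((he α i).2 x)
  rw [(hM.form α).neg_symm] at h1
  simp only [map_sum, map_smul, smul_eq_mul, hd] at h1
  simp only [true_and, mul_ite, mul_one, mul_zero, Finset.sum_ite_eq, Finset.mem_univ, if_true,
    neg_eq_zero] at h1
  rw [h1, zero_smul]

lemma eq_of_mem_Q (α : Fin k) {x : M} {v v' : TangentSpace 𝓘(ℝ, E) x} (hv : v ∈ Q x)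
    (hv' : v' ∈ Q x) (h : ∀ w ∈ subL Ω L α x, Ω α x v w = Ω α x v' w) : v = v' := by
  refine sub_eq_zero.1 (eq_zero_of_mem_Q hM hQ α ((Q x).sub_mem hv hv') fun w hw ↦ ?_)
  rw [map_sub, sub_apply, h w hw, sub_self]

/-- L_α is not assumed to be a smooth distribution; the adapted frame supplies its sections. -/
lemma exists_section_subL (α : Fin k) (x : M) {v : TangentSpace 𝓘(ℝ, E) x}
    (hv : v ∈ subL Ω L α x) : ∃ X : VF E M, IsSection (subL Ω L α) X ∧ X x = v := by
  obtain ⟨q, e, hq, he, hqe⟩ := exists_adapted_frame hM hQ x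
  obtain ⟨hs, hd⟩ := hqe.self_of_nhds
  refine ⟨fun y ↦ ∑ i, Ω α x v (q i x) • e α i y, IsSection.sum
    (X := fun i ↦ (fun _ ↦ Ω α x v (q i x)) • e α i) fun i _ ↦ (he α i).smul contMDiff_const, ?_⟩
  refine eq_of_mem_L hM hQ (Submodule.sum_mem _ fun i _ ↦
        Submodule.smul_mem _ _ ((he α i).of_subL.2 x)) (mem_subL_iff.1 hv).1 fun β w hw ↦ ?_
  have hw' := hs w hw
  clear hw
  induction hw' using Submodule.span_induction with
  | mem w hw =>
    obtain ⟨j, rfl⟩ := hw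
    simp only [map_sum, map_smul, sum_apply, smul_apply, smul_eq_mul, hd]
    by_cases hβ : α = β
    · subst hβ; simp
    · simp [hβ, (mem_subL_iff.1 hv).2 β (Ne.symm hβ)]
  | zero => simp only [map_zero]
  | add w w' _ _ h h' => rw [map_add, map_add, h, h']
  | smul t w _ h => rw [map_smul, map_smul, h]

lemma exists_section_Q_of_formOn (α : Fin k) {φ : VF E M → M → ℝ}
    (hφ : IsFormOn (subL Ω L α) φ) :
    ∃ U : VF E M, IsSection Q U ∧
      ∀ X, IsSection (subL Ω L α) X → ∀ x, Ω α x (U x) (X x) = φ X x := by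
  let P : ∀ x : M, TangentSpace 𝓘(ℝ, E) x → Prop := fun x v ↦
    v ∈ Q x ∧ ∀ X, IsSection (subL Ω L α) X →
    Ω α x v (X x) = φ X x
  have huniq : ∀ x v w, P x v → P x w → v = w := by
    rintro x v w ⟨hv, hv'⟩ ⟨hw, hw'⟩
    refine eq_of_mem_Q hM hQ α hv hw fun u hu ↦ ?_
    obtain ⟨X, hX, rfl⟩ := exists_section_subL hM hQ α x hu
    rw [hv' X hX, hw' X hX]
  have hloc : ∀ x₀, ∃ U : VF E M, IsSmoothVF U ∧ ∀ᶠ x in 𝓝 x₀, P x (U x) := by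
    intro x₀
    obtain ⟨q, e, hq, he, hqe⟩ := exists_adapted_frame hM hQ x₀
    -- The sign comes from Ω_α(q_i, e_{α i}) = -1, since duality was normalized with the arguments
    -- in the other order.
    refine ⟨fun y ↦ ∑ i, -φ (e α i) y • q i y, ?_, ?_⟩
    · exact IsSmoothVF.sum
        (X := fun i ↦ (fun y ↦ -φ (e α i) y) • q i)
        fun i _ ↦ (hq i).1.smul (hφ.smooth _ (he α i)).neg
    · filter_upwards [hqe.eventually_nhds] with y hy
      refine ⟨Submodule.sum_mem _ fun i _ ↦ Submodule.smul_mem _ _ ((hq i).2 y), fun X hX ↦ ?_⟩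
      have hX' : ∀ᶠ z in 𝓝 y, X z = ∑ i, Ω α z (X z) (q i z) • e α i z := by
        filter_upwards [hy] with z hz
        refine eq_of_mem_L hM hQ (hX.of_subL.2 z) (Submodule.sum_mem _ fun i _ ↦
          Submodule.smul_mem _ _ ((he α i).of_subL.2 z)) fun β w hw ↦ ?_
        have hw' := hz.1 w hw
        clear hw
        induction hw' using Submodule.span_induction with
        | mem w hw =>
          obtain ⟨j, rfl⟩ := hw
          simp only [map_sum, map_smul, sum_apply, smul_apply, smul_eq_mul, hz.2]
          by_cases hβ : α = β
          · subst hβ; simp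
          · simp [hβ, (mem_subL_iff.1 (hX.2 z)).2 β (Ne.symm hβ)]
        | zero => simp only [map_zero]
        | add w w' _ _ h h' => rw [map_add, map_add, h, h']
        | smul t w _ h => rw [map_smul, map_smul, h]
      rw [hφ.eq_sum (fun i ↦ (hM.form α).smoothFn hX.1 (hq i).1) (he α) hX hX',
        (hM.form α).neg_symm, hX'.self_of_nhds]
      simp only [map_sum, map_smul, sum_apply, smul_apply, smul_eq_mul, hy.self_of_nhds.2]
      simp [mul_comm]
  obtain ⟨U, hU, hP⟩ := exists_smoothVF_of_unique huniq hloc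
  exact ⟨U, ⟨hU, fun x ↦ (hP x).1⟩, fun X hX x ↦ (hP x).2 X hX⟩

/-- Every section of `L` is a sum of sections of the `L_α`. -/
lemma exists_components {X : VF E M} (hX : IsSection L X) :
    ∃ Xc : Fin k → VF E M, (∀ α, IsSection (subL Ω L α) (Xc α)) ∧ X = fun x ↦ ∑ α, Xc α x := by
  have h : ∀ α : Fin k, ∃ U : VF E M, IsSection L U ∧ ∀ β Y, IsSection Q Y → ∀ x,
      Ω β x (U x) (Y x) = if β = α then Ω β x (X x) (Y x) else 0 := by
    intro α
    -- The α-component of X is the section of L that pairs like X under Ω_α and trivially under the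
    -- other forms.
    refine exists_section_L_of_formOn hM hQ (φ := fun β Y x ↦
      if β = α then Ω β x (X x) (Y x) else 0) fun β ↦ ?_
    by_cases hβ : β = α
    · simp only [hβ, if_true]
      exact ⟨fun Y hY ↦ (hM.form α).smoothFn hX.1 hY.1, fun Y Y' _ _ x ↦ by simp,
        fun f Y _ _ x ↦ by simp⟩
    · simp only [hβ, if_false]
      exact ⟨fun Y hY ↦ contMDiff_const, fun Y Y' _ _ x ↦ by simp, fun f Y _ _ x ↦ by simp⟩
  choose Xc hXc hXc' using h
  refine ⟨Xc, fun α ↦ ⟨(hXc α).1, fun x ↦ mem_subL_of_forall hM hQ ((hXc α).2 x)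
    fun β hβ w hw ↦ ?_⟩, funext fun x ↦ ?_⟩
  · obtain ⟨Y, hY, rfl⟩ := hQ.foliation.smooth.exists_section x hw
    rw [hXc' α β Y hY, if_neg hβ]
  · refine eq_of_mem_L hM hQ (hX.2 x) (Submodule.sum_mem _ fun α _ ↦ (hXc α).2 x) fun β w hw ↦ ?_
    obtain ⟨Y, hY, rfl⟩ := hQ.foliation.smooth.exists_section x hw
    simp only [map_sum, sum_apply, hXc' _ β Y hY]
    simp

end Representation

/-! ### The forms ψ^{A B} as expressions in A, B and the test field. -/

section Psi

variable {E : Type*} [NormedAddCommGroup E] [NormedSpace ℝ E] [CompleteSpace E]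
  {M : Type*} [TopologicalSpace M] [ChartedSpace E M] [IsManifold 𝓘(ℝ, E) ∞ M]
  {η : BilinField E M}

omit [CompleteSpace E] in
lemma IsClosedTwoForm.mdiffAt (hη : IsClosedTwoForm η) {X Y : VF E M} (hX : IsSmoothVF X)
    (hY : IsSmoothVF Y) (x : M) :
    MDifferentiableAt 𝓘(ℝ, E) 𝓘(ℝ, ℝ) (fun y ↦ η y (X y) (Y y)) x :=
  (hη.smoothFn hX hY).mdiffAt x

variable (hη : IsClosedTwoForm η) {A A' B B' Z Z' : VF E M} {f : M → ℝ}
  (hA : IsSmoothVF A) (hA' : IsSmoothVF A') (hB : IsSmoothVF B) (hB' : IsSmoothVF B')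
  (hZ : IsSmoothVF Z) (hZ' : IsSmoothVF Z') (hf : SmoothFn (E := E) f)

include hη

include hA hB hZ in
lemma psi_smooth : SmoothFn (E := E) (psi η A B Z) :=
  ((hη.smoothFn hB hZ).dirDeriv hA).sub (hη.smoothFn hB (hA.mlieBracket hZ))

include hB hZ hZ' in
lemma psi_add_right (x : M) : psi η A B (Z + Z') x = psi η A B Z x + psi η A B Z' x := by
  have h := dirDeriv_add (hη.mdiffAt hB hZ x) (hη.mdiffAt hB hZ' x) (A x)
  simp only [psi, Pi.add_apply, map_add, h, mlieBracket_add_right' hZ hZ']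
  ring

include hB hZ hf in
lemma psi_smul_right (x : M) : psi η A B (f • Z) x = f x * psi η A B Z x := by
  have h := dirDeriv_mul (hf.mdiffAt x) (hη.mdiffAt hB hZ x) (A x)
  simp only [psi, Pi.smul_apply', map_smul, smul_eq_mul, h, mlieBracket_smul_right' hf hZ, map_add]
  ring

omit hη in
include hA hA' in
lemma psi_add_left (x : M) : psi η (A + A') B Z x = psi η A B Z x + psi η A' B Z x := by
  simp only [psi, Pi.add_apply, map_add, dirDeriv_add_right, mlieBracket_add_left' hA hA']
  ring

omit hη in
include hA hf in
-- The derivative of f enters through [f A, Z] with factor η(B, A). Isotropy kills it, which makes ψ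
-- tensorial in A.
lemma psi_smul_left (x : M) (h0 : η x (B x) (A x) = 0) :
    psi η (f • A) B Z x = f x * psi η A B Z x := by
  simp only [psi, Pi.smul_apply', map_smul, smul_eq_mul, dirDeriv_smul_right, map_add, h0,
    mlieBracket_smul_left' hf hA]
  ring

omit [CompleteSpace E] in
include hB hB' hZ in
lemma psi_add_mid (x : M) : psi η A (B + B') Z x = psi η A B Z x + psi η A B' Z x := by
  have h := dirDeriv_add (hη.mdiffAt hB hZ x) (hη.mdiffAt hB' hZ x) (A x)
  simp only [psi, Pi.add_apply, map_add, add_apply, h]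
  ring

omit [CompleteSpace E] in
include hB hZ hf in
lemma psi_smul_mid (x : M) :
    psi η A (f • B) Z x = dirDeriv f x (A x) * η x (B x) (Z x) + f x * psi η A B Z x := by
  have h := dirDeriv_mul (hf.mdiffAt x) (hη.mdiffAt hB hZ x) (A x)
  simp only [psi, Pi.smul_apply', map_smul, smul_apply, smul_eq_mul, h]
  ring

include hA hB in
lemma psi_isFormOn (D : Distr E M) : IsFormOn D (psi η A B) :=
  ⟨fun _ hX ↦ psi_smooth hη hA hB hX.1, fun _ _ hX hY ↦ psi_add_right hη hB hX.1 hY.1,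
    fun _ _ hf hX ↦ psi_smul_right hη hB hX.1 hf⟩

end Psi

/-! ### The diagonal blocks of the connection, for L and Q at once. -/

section Rep

variable {E : Type*} [NormedAddCommGroup E] [NormedSpace ℝ E] [CompleteSpace E]
  {M : Type*} [TopologicalSpace M] [ChartedSpace E M] [IsManifold 𝓘(ℝ, E) ∞ M]
  {k : ℕ} {Ω : Fin k → BilinField E M} {D : Distr E M} {T : Fin k → Distr E M}

/-- The section `U` of `D` represents the `1`-forms `ψ_α^{A B}` on the distributions `T α`. -/
def Represents (Ω : Fin k → BilinField E M) (D : Distr E M) (T : Fin k → Distr E M)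
    (A B U : VF E M) : Prop :=
  IsSection D U ∧ ∀ α Z, IsSection (T α) Z → ∀ x, Ω α x (U x) (Z x) = psi (Ω α) A B Z x

/-- The section of `D` which represents the `1`-forms `ψ_α^{A B}`, if there is one. -/
def rep (Ω : Fin k → BilinField E M) (D : Distr E M) (T : Fin k → Distr E M) (A B : VF E M) :
    VF E M :=
  Classical.epsilon (Represents Ω D T A B)

/-- Sections of `D` represent the `1`-forms `ψ_α^{A B}`, uniquely. -/
structure IsRepresenting (Ω : Fin k → BilinField E M) (D : Distr E M) (T : Fin k → Distr E M) :
    Prop where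
  form : ∀ α, IsClosedTwoForm (Ω α)
  isotropic : ∀ α x, ∀ v ∈ D x, ∀ w ∈ D x, Ω α x v w = 0
  exists_rep : ∀ A B : VF E M, IsSection D A → IsSection D B → ∃ U, Represents Ω D T A B U
  unique : ∀ U U' : VF E M, IsSection D U → IsSection D U' →
    (∀ α Z, IsSection (T α) Z → ∀ x, Ω α x (U x) (Z x) = Ω α x (U' x) (Z x)) → U = U'

namespace IsRepresenting

variable (hD : IsRepresenting Ω D T)
include hD

omit [CompleteSpace E] in
lemma rep_spec {A B : VF E M} (hA : IsSection D A) (hB : IsSection D B) :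
    Represents Ω D T A B (rep Ω D T A B) := Classical.epsilon_spec (hD.exists_rep A B hA hB)

omit [CompleteSpace E] in
lemma rep_eq {A B U : VF E M} (hA : IsSection D A) (hB : IsSection D B)
    (hU : Represents Ω D T A B U) : rep Ω D T A B = U :=
  hD.unique _ _ (hD.rep_spec hA hB).1 hU.1 fun α Z hZ x ↦ by
    rw [(hD.rep_spec hA hB).2 α Z hZ, hU.2 α Z hZ]

variable {A A' B B' : VF E M} {f : M → ℝ} (hA : IsSection D A) (hA' : IsSection D A')
  (hB : IsSection D B) (hB' : IsSection D B') (hf : SmoothFn (E := E) f)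

include hA hA' hB in
lemma rep_add_left : rep Ω D T (A + A') B = rep Ω D T A B + rep Ω D T A' B := by
  refine hD.rep_eq (hA.add hA') hB ⟨(hD.rep_spec hA hB).1.add (hD.rep_spec hA' hB).1,
    fun α Z hZ x ↦ ?_⟩
  rw [psi_add_left hA.1 hA'.1, Pi.add_apply, map_add, add_apply,
    (hD.rep_spec hA hB).2 α Z hZ, (hD.rep_spec hA' hB).2 α Z hZ]

include hA hB hf in
lemma rep_smul_left : rep Ω D T (f • A) B = f • rep Ω D T A B := by
  refine hD.rep_eq (hA.smul hf) hB ⟨(hD.rep_spec hA hB).1.smul hf, fun α Z hZ x ↦ ?_⟩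
  rw [psi_smul_left hA.1 hf _ (hD.isotropic α x _ (hB.2 x) _ (hA.2 x)),
    Pi.smul_apply', map_smul, smul_apply, (hD.rep_spec hA hB).2 α Z hZ, smul_eq_mul]

omit [CompleteSpace E] in
include hA hB hB' in
lemma rep_add_right : rep Ω D T A (B + B') = rep Ω D T A B + rep Ω D T A B' := by
  refine hD.rep_eq hA (hB.add hB') ⟨(hD.rep_spec hA hB).1.add (hD.rep_spec hA hB').1,
    fun α Z hZ x ↦ ?_⟩
  rw [psi_add_mid (hD.form α) hB.1 hB'.1 hZ.1, Pi.add_apply, map_add, add_apply,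
    (hD.rep_spec hA hB).2 α Z hZ, (hD.rep_spec hA hB').2 α Z hZ]

omit [CompleteSpace E] in
include hA hB hf in
lemma rep_smul_right :
    rep Ω D T A (f • B) = (fun x ↦ dirDeriv f x (A x)) • B + f • rep Ω D T A B := by
  refine hD.rep_eq hA (hB.smul hf) ⟨(hB.smul (hf.dirDeriv hA.1)).add
    ((hD.rep_spec hA hB).1.smul hf), fun α Z hZ x ↦ ?_⟩
  rw [psi_smul_mid (hD.form α) hB.1 hZ.1 hf, Pi.add_apply, Pi.smul_apply', Pi.smul_apply', map_add,
    map_smul, map_smul, add_apply, smul_apply, smul_apply, (hD.rep_spec hA hB).2 α Z hZ,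
    smul_eq_mul, smul_eq_mul]

include hB in
lemma rep_zero_left : rep Ω D T 0 B = 0 := by
  have h := hD.rep_add_left (isSection_zero D) (isSection_zero D) hB
  simpa using h

omit [CompleteSpace E] in
include hA in
lemma rep_zero_right : rep Ω D T A 0 = 0 := by
  have h := hD.rep_add_right hA (isSection_zero D) (isSection_zero D)
  simpa using h

end IsRepresenting

end Rep

/-! ### Construction of the connection from its four blocks. -/

section Connection

variable {E : Type*} [NormedAddCommGroup E] [NormedSpace ℝ E] [FiniteDimensional ℝ E]
  {M : Type*} [TopologicalSpace M] [T2Space M] [ChartedSpace E M] [IsManifold 𝓘(ℝ, E) ∞ M]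
  {n k : ℕ} {Ω : Fin k → BilinField E M} {L Q : Distr E M}

/-- The covariant derivatives of sections of `L` and `Q` along such sections which the canonical
connection must have. -/
structure IsAdaptedConn (Ω : Fin k → BilinField E M) (L Q : Distr E M)
    (h : ∀ x, IsCompl (L x) (Q x)) (cov : LinConn E M) : Prop where
  LL_mem : ∀ X X' : VF E M, IsSection L X → IsSection L X' → ∀ x, cov X' x (X x) ∈ L x
  LL : ∀ X X' : VF E M, IsSection L X → IsSection L X' → ∀ α Y, IsSection Q Y → ∀ x,
    Ω α x (cov X' x (X x)) (Y x) = psi (Ω α) X X' Y x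
  QQ_mem : ∀ Y Y' : VF E M, IsSection Q Y → IsSection Q Y' → ∀ x, cov Y' x (Y x) ∈ Q x
  QQ : ∀ Y Y' : VF E M, IsSection Q Y → IsSection Q Y' → ∀ α X, IsSection (subL Ω L α) X → ∀ x,
    Ω α x (cov Y' x (Y x)) (X x) = psi (Ω α) Y Y' X x
  QL : ∀ X Y : VF E M, IsSection L X → IsSection Q Y → ∀ x,
    cov X x (Y x) = proj h (mlieBracket 𝓘(ℝ, E) Y X) x
  LQ : ∀ X Y : VF E M, IsSection L X → IsSection Q Y → ∀ x,
    cov Y x (X x) = proj (fun x ↦ (h x).symm) (mlieBracket 𝓘(ℝ, E) X Y) x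

variable (hM : IsKSymplectic n k Ω L) (hQ : IsAdmissible n Ω L Q)
include hM hQ

lemma isRepresenting_L : IsRepresenting Ω L (fun _ ↦ Q) where
  form := hM.form
  isotropic := hM.isotropic
  exists_rep A B hA hB := exists_section_L_of_formOn hM hQ fun α ↦
    psi_isFormOn (hM.form α) hA.1 hB.1 Q
  unique U U' hU hU' h := funext fun x ↦ eq_of_mem_L hM hQ (hU.2 x) (hU'.2 x) fun α w hw ↦ by
    obtain ⟨Z, hZ, rfl⟩ := hQ.foliation.smooth.exists_section x hw
    exact h α Z hZ x

lemma eq_zero_of_mem_Q' {x : M} {v : TangentSpace 𝓘(ℝ, E) x} (hv : v ∈ Q x)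
    (h : ∀ α, ∀ w ∈ subL Ω L α x, Ω α x v w = 0) : v = 0 := by
  -- For k = 0 the empty intersection of characteristic spaces is everything, so nondegeneracy
  -- forces the tangent space to be zero.
  rcases isEmpty_or_nonempty (Fin k) with hk | ⟨⟨α₀⟩⟩
  · rw [← Submodule.mem_bot ℝ, ← hM.nondegenerate x, iInf_of_empty]; exact Submodule.mem_top
  · exact eq_zero_of_mem_Q hM hQ α₀ hv (h α₀)

/-- For every α there is a section of Q representing ψ_α; condition (iii) makes it the same for all
α, so that one section of Q serves all forms. -/
lemma isRepresenting_Q : IsRepresenting Ω Q (subL Ω L) where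
  form := hM.form
  isotropic := hQ.isotropic
  exists_rep A B hA hB := by
    have h : ∀ α, ∃ U : VF E M, IsSection Q U ∧ ∀ X, IsSection (subL Ω L α) X → ∀ x,
        Ω α x (U x) (X x) = psi (Ω α) A B X x := fun α ↦
      exists_section_Q_of_formOn hM hQ α (psi_isFormOn (hM.form α) hA.1 hB.1 _)
    choose U hU hU' using h
    rcases isEmpty_or_nonempty (Fin k) with hk | ⟨⟨α₀⟩⟩
    · exact ⟨0, isSection_zero Q, fun α ↦ hk.elim α⟩
    · refine ⟨U α₀, hU α₀, fun α Z hZ x ↦ ?_⟩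
      rw [← hU' α Z hZ x, hQ.psi_eq A B hA hB x α₀ α (U α₀ x) (U α x)
        ⟨(hU α₀).2 x, fun X hX ↦ hU' α₀ X hX x⟩ ⟨(hU α).2 x, fun X hX ↦ hU' α X hX x⟩]
  unique U U' hU hU' h := by
    funext x
    refine sub_eq_zero.1 (eq_zero_of_mem_Q' hM hQ ((Q x).sub_mem (hU.2 x) (hU'.2 x))
      fun α w hw ↦ ?_)
    obtain ⟨Z, hZ, rfl⟩ := exists_section_subL hM hQ α x hw
    rw [map_sub, sub_apply, h α Z hZ x, sub_self]

/-- The formulas forced on a canonical connection, extended to all fields by splitting both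
arguments with P and R, satisfy the axioms of a connection. -/
theorem exists_isAdaptedConn : ∃ cov : LinConn E M, IsSmoothConn cov ∧
    IsAdaptedConn Ω L Q hQ.transversal cov := by
  let P := proj hQ.transversal
  let R := proj (fun x ↦ (hQ.transversal x).symm)
  have hP : ∀ {V : VF E M}, IsSmoothVF V → IsSection L (P V) := fun h ↦ .proj_L hM hQ h
  have hR : ∀ {V : VF E M}, IsSmoothVF V → IsSection Q (R V) := fun h ↦ .proj_Q hM hQ h
  have rL := isRepresenting_L hM hQ
  have rQ := isRepresenting_Q hM hQ
  have Padd : ∀ V W, P (V + W) = P V + P W := proj_add _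
  have Radd : ∀ V W, R (V + W) = R V + R W := proj_add _
  have Psmul : ∀ f V, P (f • V) = f • P V := proj_smul _
  have Rsmul : ∀ f V, R (f • V) = f • R V := proj_smul _
  have PL : ∀ {V : VF E M}, IsSection L V → P V = V := fun h ↦
    funext fun x ↦ proj_eq_self _ (h.2 x)
  have PQ : ∀ {V : VF E M}, IsSection Q V → P V = 0 := fun h ↦
    funext fun x ↦ proj_eq_zero _ (h.2 x)
  have RL : ∀ {V : VF E M}, IsSection L V → R V = 0 := fun h ↦
    funext fun x ↦ proj_eq_zero _ (h.2 x)
  have RQ : ∀ {V : VF E M}, IsSection Q V → R V = V := fun h ↦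
    funext fun x ↦ proj_eq_self _ (h.2 x)
  have PR : ∀ V, P V + R V = V := fun V ↦ funext fun x ↦ proj_add_proj _ V x
  let B : VF E M → VF E M → VF E M := fun V W ↦
    rep Ω L (fun _ ↦ Q) (P V) (P W) + P (mlieBracket 𝓘(ℝ, E) (R V) (P W))
      + R (mlieBracket 𝓘(ℝ, E) (P V) (R W)) + rep Ω Q (subL Ω L) (R V) (R W)
  have addr : ∀ {X Y Y' : VF E M}, IsSmoothVF Y → IsSmoothVF Y' →
      mlieBracket 𝓘(ℝ, E) X (Y + Y') = mlieBracket 𝓘(ℝ, E) X Y + mlieBracket 𝓘(ℝ, E) X Y' :=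
    fun h h' ↦ funext fun x ↦ mlieBracket_add_right' h h' x
  have addl : ∀ {X X' Y : VF E M}, IsSmoothVF X → IsSmoothVF X' →
      mlieBracket 𝓘(ℝ, E) (X + X') Y = mlieBracket 𝓘(ℝ, E) X Y + mlieBracket 𝓘(ℝ, E) X' Y :=
    fun h h' ↦ funext fun x ↦ mlieBracket_add_left' h h' x
  have smulr : ∀ {f : M → ℝ} {X Y : VF E M}, SmoothFn (E := E) f → IsSmoothVF Y →
      mlieBracket 𝓘(ℝ, E) X (f • Y)
        = (fun x ↦ dirDeriv f x (X x)) • Y + f • mlieBracket 𝓘(ℝ, E) X Y :=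
    fun h h' ↦ funext fun x ↦ mlieBracket_smul_right' h h' x
  have smull : ∀ {f : M → ℝ} {X Y : VF E M}, SmoothFn (E := E) f → IsSmoothVF X →
      mlieBracket 𝓘(ℝ, E) (f • X) Y
        = (fun x ↦ -dirDeriv f x (Y x)) • X + f • mlieBracket 𝓘(ℝ, E) X Y :=
    fun h h' ↦ funext fun x ↦ mlieBracket_smul_left' h h' x
  have hB : IsConnOp B :=
    { smooth := fun V W hV hW ↦
        ((((rL.rep_spec (hP hV) (hP hW)).1.1).add
          (hP ((hR hV).1.mlieBracket (hP hW).1)).1).add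
          (hR ((hP hV).1.mlieBracket (hR hW).1)).1).add (rQ.rep_spec (hR hV) (hR hW)).1.1
      add_left := fun V V' W hV hV' hW ↦ by
        simp only [B, Padd, Radd, rL.rep_add_left (hP hV) (hP hV') (hP hW),
          rQ.rep_add_left (hR hV) (hR hV') (hR hW), addl (hR hV).1 (hR hV').1,
          addl (hP hV).1 (hP hV').1]
        abel
      add_right := fun V W W' hV hW hW' ↦ by
        simp only [B, Padd, Radd, rL.rep_add_right (hP hV) (hP hW) (hP hW'),
          rQ.rep_add_right (hR hV) (hR hW) (hR hW'), addr (hR hW).1 (hR hW').1,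
          addr (hP hW).1 (hP hW').1]
        abel
      -- The brackets of f • R V and f • P V produce derivative terms along R V and P V, which the
      -- outer projections P and R annihilate.
      smul_left := fun f V W hf hV hW ↦ by
        simp only [B, Psmul, Rsmul, rL.rep_smul_left (hP hV) (hP hW) hf,
          rQ.rep_smul_left (hR hV) (hR hW) hf, smull hf (hR hV).1, smull hf (hP hV).1,
          Padd, Radd, PQ (hR hV), RL (hP hV), smul_zero, zero_add, smul_add]
      leibniz := fun f V W hf hV hW ↦ by
        -- The derivative term splits into four pieces, one for each block of `B`.
        have hPR : (fun x ↦ dirDeriv f x (V x)) • W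
            = (fun x ↦ dirDeriv f x (P V x)) • P W + (fun x ↦ dirDeriv f x (R V x)) • P W
              + ((fun x ↦ dirDeriv f x (P V x)) • R W + (fun x ↦ dirDeriv f x (R V x)) • R W) := by
          funext x
          have e1 : dirDeriv f x (V x) = dirDeriv f x (P V x) + dirDeriv f x (R V x) := by
            rw [← dirDeriv_add_right, ← Pi.add_apply, PR]
          have e2 : W x = P W x + R W x := by rw [← Pi.add_apply, PR]
          simp only [Pi.smul_apply', Pi.add_apply]
          rw [e1, e2]
          module
        simp only [B, Psmul, Rsmul, rL.rep_smul_right (hP hV) (hP hW) hf,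
          rQ.rep_smul_right (hR hV) (hR hW) hf, smulr hf (hR hW).1, smulr hf (hP hW).1,
          Padd, Radd, PL (hP hW), RQ (hR hW), smul_add, hPR]
        abel }
  obtain ⟨cov, hcov, hcB⟩ := hB.exists_linConn
  have z1 : ∀ V : VF E M, mlieBracket 𝓘(ℝ, E) V 0 = 0 := fun V ↦ mlieBracket_zero_right
  have z2 : ∀ V : VF E M, mlieBracket 𝓘(ℝ, E) 0 V = 0 := fun V ↦ mlieBracket_zero_left
  have P0 : P 0 = 0 := PL (isSection_zero L)
  have R0 : R 0 = 0 := RQ (isSection_zero Q)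
  have BLL : ∀ X X' : VF E M, IsSection L X → IsSection L X' →
      B X X' = rep Ω L (fun _ ↦ Q) X X' := fun X X' h h' ↦ by
    simp only [B, PL h, PL h', RL h, RL h', z1, z2, P0, R0,
      rQ.rep_zero_left (isSection_zero Q), add_zero]
  have BQQ : ∀ X X' : VF E M, IsSection Q X → IsSection Q X' →
      B X X' = rep Ω Q (subL Ω L) X X' := fun X X' h h' ↦ by
    simp only [B, PQ h, PQ h', RQ h, RQ h', z1, z2, P0, R0,
      rL.rep_zero_left (isSection_zero L), zero_add]
  refine ⟨cov, hcov, ?_, ?_, ?_, ?_, ?_, ?_⟩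
  · intro X X' h h' x
    rw [hcB X X' h.1 h'.1, BLL X X' h h']
    exact (rL.rep_spec h h').1.2 x
  · intro X X' h h' α Y hY x
    rw [hcB X X' h.1 h'.1, BLL X X' h h']
    exact (rL.rep_spec h h').2 α Y hY x
  · intro X X' h h' x
    rw [hcB X X' h.1 h'.1, BQQ X X' h h']
    exact (rQ.rep_spec h h').1.2 x
  · intro X X' h h' α Y hY x
    rw [hcB X X' h.1 h'.1, BQQ X X' h h']
    exact (rQ.rep_spec h h').2 α Y hY x
  · intro X Y h h' x
    rw [hcB Y X h'.1 h.1]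
    simp only [B, PQ h', PL h, RL h, RQ h', z1, R0, rL.rep_zero_left h, rQ.rep_zero_right h',
      zero_add, add_zero]
    rfl
  · intro X Y h h' x
    rw [hcB X Y h.1 h'.1]
    simp only [B, PQ h', PL h, RL h, RQ h', z2, P0, rL.rep_zero_right h, rQ.rep_zero_left h',
      zero_add, add_zero]
    rfl

end Connection

/-! ### Linear connections on smooth vector fields. -/

section LinConn

variable {E : Type*} [NormedAddCommGroup E] [NormedSpace ℝ E]
  {M : Type*} [TopologicalSpace M] [ChartedSpace E M] [IsManifold 𝓘(ℝ, E) ∞ M]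
  (cov : LinConn E M)

lemma linConn_add {W W' : VF E M} (hW : IsSmoothVF W) (hW' : IsSmoothVF W') (x : M) :
    cov (W + W') x = cov W x + cov W' x :=
  cov.isCovariantDerivativeOnUniv.add (hW.mdiffAt x) (hW'.mdiffAt x)

lemma linConn_smul {f : M → ℝ} {W : VF E M} (hf : SmoothFn (E := E) f) (hW : IsSmoothVF W) (x : M)
    (v : TangentSpace 𝓘(ℝ, E) x) :
    cov (f • W) x v = f x • cov W x v + dirDeriv f x v • W x :=
  congrArg (fun l ↦ l v) (cov.isCovariantDerivativeOnUniv.leibniz (hW.mdiffAt x) (hf.mdiffAt x))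

lemma linConn_sum {ι : Type*} (s : Finset ι) {W : ι → VF E M} (hW : ∀ i, IsSmoothVF (W i)) (x : M)
    (v : TangentSpace 𝓘(ℝ, E) x) :
    cov (fun y ↦ ∑ i ∈ s, W i y) x v = ∑ i ∈ s, cov (W i) x v := by
  classical
  induction s using Finset.induction_on with
  | empty =>
    have : cov (fun y : M ↦ (0 : TangentSpace 𝓘(ℝ, E) y)) = 0 := cov.zero
    simp only [Finset.sum_empty, this]; rfl
  | insert a s ha ih =>
    have e : (fun y ↦ ∑ i ∈ insert a s, W i y) = W a + fun y ↦ ∑ i ∈ s, W i y := by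
      funext y; simp [Finset.sum_insert ha]
    rw [e, linConn_add cov (hW a) (IsSmoothVF.sum fun i _ ↦ hW i), add_apply, ih,
      Finset.sum_insert ha]

lemma linConn_congr {W W' : VF E M} (hW : IsSmoothVF W) (hW' : IsSmoothVF W') {x : M}
    (h : ∀ᶠ y in 𝓝 x, W y = W' y) : cov W x = cov W' x :=
  cov.isCovariantDerivativeOnUniv.congr_of_eventuallyEq (hW.mdiffAt x) (hW'.mdiffAt x)
    Filter.univ_mem h

variable {cov}

lemma IsSmoothConn.smoothVF (hcov : IsSmoothConn cov) {V W : VF E M} (hV : IsSmoothVF V)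
    (hW : IsSmoothVF W) : IsSmoothVF (fun x ↦ cov W x (V x)) := by
  have h := contMDiffOn_univ.1 (hcov.contMDiff.contMDiff (σ := W) (contMDiffOn_univ.2 hW))
  exact ContMDiff.clm_bundle_apply h hV

lemma curvature_add [CompleteSpace E] (hcov : IsSmoothConn cov) {X Y Z Z' : VF E M}
    (hX : IsSmoothVF X) (hY : IsSmoothVF Y) (hZ : IsSmoothVF Z) (hZ' : IsSmoothVF Z') (x : M) :
    curvature cov X Y (Z + Z') x = curvature cov X Y Z x + curvature cov X Y Z' x := by
  have e : ∀ V : VF E M, (fun y ↦ cov (Z + Z') y (V y))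
      = (fun y ↦ cov Z y (V y)) + fun y ↦ cov Z' y (V y) := fun V ↦ by
    funext y; rw [linConn_add cov hZ hZ']; rfl
  rw [curvature, e, e, linConn_add cov (hcov.smoothVF hY hZ) (hcov.smoothVF hY hZ'),
    linConn_add cov (hcov.smoothVF hX hZ) (hcov.smoothVF hX hZ'), linConn_add cov hZ hZ']
  simp only [curvature, add_apply]
  abel

end LinConn

/-! ### Curvature: skewness for parallel forms, flatness of bracket connections. -/

section Curvature

variable {E : Type*} [NormedAddCommGroup E] [NormedSpace ℝ E] [FiniteDimensional ℝ E]
  {M : Type*} [TopologicalSpace M] [T2Space M] [ChartedSpace E M] [IsManifold 𝓘(ℝ, E) ∞ M]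
  {cov : LinConn E M}

/-- The curvature of a connection is skew for a parallel form. -/
lemma curvature_skew (hcov : IsSmoothConn cov) {η : BilinField E M} (hη : IsClosedTwoForm η)
    (hpar : ∀ W W' : VF E M, IsSmoothVF W → IsSmoothVF W' → ∀ x v,
      dirDeriv (fun y ↦ η y (W y) (W' y)) x v = η x (cov W x v) (W' x) + η x (W x) (cov W' x v))
    {V V' W W' : VF E M} (hV : IsSmoothVF V) (hV' : IsSmoothVF V') (hW : IsSmoothVF W)
    (hW' : IsSmoothVF W') (x : M) :
    η x (curvature cov V V' W x) (W' x) = -η x (W x) (curvature cov V V' W' x) := by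
  have second : ∀ A B : VF E M, IsSmoothVF A → IsSmoothVF B →
      dirDeriv (fun y ↦ dirDeriv (fun z ↦ η z (W z) (W' z)) y (B y)) x (A x)
        = η x (cov (fun y ↦ cov W y (B y)) x (A x)) (W' x)
          + η x (cov W x (B x)) (cov W' x (A x))
          + (η x (cov W x (A x)) (cov W' x (B x))
          + η x (W x) (cov (fun y ↦ cov W' y (B y)) x (A x))) := by
    intro A B hA hB
    have hWB := hcov.smoothVF hB hW
    have hWB' := hcov.smoothVF hB hW'
    simp only [hpar W W' hW hW']
    rw [dirDeriv_add (hη.mdiffAt hWB hW' x) (hη.mdiffAt hW hWB' x), hpar _ _ hWB hW',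
      hpar _ _ hW hWB']
  have h := dirDeriv_mlieBracket (hη.smoothFn hW hW') hV hV' x
  -- In the difference of the two second derivatives the products of first derivatives cancel, being
  -- symmetric in V and V'.
  rw [second V V' hV hV', second V' V hV' hV, hpar W W' hW hW'] at h
  simp only [curvature, map_sub, sub_apply]
  linarith

omit [T2Space M] in
/-- Flatness of a connection which on sections of `D'` along `D` is given by the brackets. -/
lemma curvature_eq_zero_of_bracket {D D' : Distr E M} (h : ∀ x, IsCompl (D x) (D' x))
    (hD : ∀ X Y : VF E M, IsSection D X → IsSection D Y →
      ∀ x, mlieBracket 𝓘(ℝ, E) X Y x ∈ D x)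
    (hp : ∀ V : VF E M, IsSmoothVF V → IsSection D (proj h V))
    (hp' : ∀ V : VF E M, IsSmoothVF V → IsSection D' (proj (fun x ↦ (h x).symm) V))
    (hc : ∀ X Y : VF E M, IsSection D X → IsSection D' Y → ∀ x,
      cov Y x (X x) = proj (fun x ↦ (h x).symm) (mlieBracket 𝓘(ℝ, E) X Y) x)
    {X X' Y : VF E M} (hX : IsSection D X) (hX' : IsSection D X') (hY : IsSection D' Y) (x : M) :
    curvature cov X X' Y x = 0 := by
  let h' := fun x ↦ (h x).symm
  have second : ∀ A B : VF E M, IsSection D A → IsSection D B →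
      cov (fun y ↦ cov Y y (B y)) x (A x)
        = proj h' (mlieBracket 𝓘(ℝ, E) A (mlieBracket 𝓘(ℝ, E) B Y)) x := by
    intro A B hA hB
    have e : (fun y ↦ cov Y y (B y)) = proj h' (mlieBracket 𝓘(ℝ, E) B Y) :=
      funext fun y ↦ hc B Y hB hY y
    have hBY := hB.1.mlieBracket hY.1
    have e2 : mlieBracket 𝓘(ℝ, E) B Y
        = proj h (mlieBracket 𝓘(ℝ, E) B Y) + proj h' (mlieBracket 𝓘(ℝ, E) B Y) :=
      funext fun y ↦ (proj_add_proj h _ y).symm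
    rw [e, hc A _ hA (hp' _ hBY)]
    conv_rhs => rw [e2]
    have e3 : mlieBracket 𝓘(ℝ, E) A (proj h (mlieBracket 𝓘(ℝ, E) B Y)
        + proj h' (mlieBracket 𝓘(ℝ, E) B Y))
        = mlieBracket 𝓘(ℝ, E) A (proj h (mlieBracket 𝓘(ℝ, E) B Y))
          + mlieBracket 𝓘(ℝ, E) A (proj h' (mlieBracket 𝓘(ℝ, E) B Y)) :=
      funext fun y ↦ mlieBracket_add_right' (hp _ hBY).1 (hp' _ hBY).1 y
    -- The D-part of [B, Y] has its bracket with A in D by involutivity, so the projection drops it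
    -- and the inner projection can be omitted. Flatness is then the Jacobi identity.
    rw [e3, proj_add, Pi.add_apply, proj_eq_zero h' (hD _ _ hA (hp _ hBY) x), zero_add]
  have hXX' : IsSection D (mlieBracket 𝓘(ℝ, E) X X') := ⟨hX.1.mlieBracket hX'.1, hD X X' hX hX'⟩
  have J : mlieBracket 𝓘(ℝ, E) X (mlieBracket 𝓘(ℝ, E) X' Y)
      = mlieBracket 𝓘(ℝ, E) (mlieBracket 𝓘(ℝ, E) X X') Y
        + mlieBracket 𝓘(ℝ, E) X' (mlieBracket 𝓘(ℝ, E) X Y) :=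
    funext fun y ↦ mlieBracket_jacobi hX.1 hX'.1 hY.1 y
  rw [curvature, second X X' hX hX', second X' X hX' hX, hc _ Y hXX' hY, J, proj_add, Pi.add_apply]
  abel

end Curvature

/-! ### Adapted connections are exactly the canonical ones; their torsion and curvature. -/

section Canonical

variable {E : Type*} [NormedAddCommGroup E] [NormedSpace ℝ E] [FiniteDimensional ℝ E]
  {M : Type*} [TopologicalSpace M] [T2Space M] [ChartedSpace E M] [IsManifold 𝓘(ℝ, E) ∞ M]
  {n k : ℕ} {Ω : Fin k → BilinField E M} {L Q : Distr E M} {cov : LinConn E M}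
  (hM : IsKSymplectic n k Ω L) (hQ : IsAdmissible n Ω L Q)

include hQ in
omit [FiniteDimensional ℝ E] [T2Space M] in
-- With `form_proj_L`, this lets a projected bracket be replaced by the bracket inside a form, which
-- yields the expression ψ.
lemma form_proj_Q {α : Fin k} {x : M} {v : TangentSpace 𝓘(ℝ, E) x} (hM : IsKSymplectic n k Ω L)
    (hv : v ∈ L x) (V : VF E M) :
    Ω α x v (proj (fun x ↦ (hQ.transversal x).symm) V x) = Ω α x v (V x) := by
  conv_rhs => rw [← proj_add_proj hQ.transversal V x]
  rw [map_add, hM.isotropic α x _ hv _ (proj_mem _ V x), zero_add]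

include hQ in
omit [FiniteDimensional ℝ E] [T2Space M] in
lemma form_proj_L {α : Fin k} {x : M} {v : TangentSpace 𝓘(ℝ, E) x} (hv : v ∈ Q x) (V : VF E M) :
    Ω α x v (proj hQ.transversal V x) = Ω α x v (V x) := by
  conv_rhs => rw [← proj_add_proj hQ.transversal V x]
  rw [map_add, hQ.isotropic α x _ hv _ (proj_mem _ V x), add_zero]

include hM hQ in
/-- Tangent vectors are values of sums of sections of `L` and `Q`. -/
lemma exists_sections_add (x : M) (v : TangentSpace 𝓘(ℝ, E) x) :
    ∃ A B : VF E M, IsSection L A ∧ IsSection Q B ∧ v = A x + B x := by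
  obtain ⟨l, hl, q, hq, rfl⟩ := hQ.exists_add x v
  obtain ⟨A, hA, rfl⟩ := hM.foliation.smooth.exists_section x hl
  obtain ⟨B, hB, rfl⟩ := hQ.foliation.smooth.exists_section x hq
  exact ⟨A, B, hA, hB, rfl⟩

namespace IsAdaptedConn

variable (hc : IsAdaptedConn Ω L Q hQ.transversal cov)
include hM hc

lemma mem_L {X : VF E M} (hX : IsSection L X) (x : M) (v : TangentSpace 𝓘(ℝ, E) x) :
    cov X x v ∈ L x := by
  obtain ⟨A, B, hA, hB, rfl⟩ := exists_sections_add hM hQ x v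
  rw [map_add, hc.QL X B hX hB]
  exact (L x).add_mem (hc.LL_mem A X hA hX x) (proj_mem _ _ x)

lemma mem_Q {Y : VF E M} (hY : IsSection Q Y) (x : M) (v : TangentSpace 𝓘(ℝ, E) x) :
    cov Y x v ∈ Q x := by
  obtain ⟨A, B, hA, hB, rfl⟩ := exists_sections_add hM hQ x v
  rw [map_add, hc.LQ A Y hA hY]
  exact (Q x).add_mem (proj_mem _ _ x) (hc.QQ_mem B Y hB hY x)

/-- Along L, ψ_β^{A X} vanishes for β ≠ α because X lies in the kernel of Ω_β. Along Q, the
derivative is P[B, X], and condition (ii) puts it in L_α. -/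
lemma mem_subL {α : Fin k} {X : VF E M} (hX : IsSection (subL Ω L α) X) (x : M)
    (v : TangentSpace 𝓘(ℝ, E) x) : cov X x v ∈ subL Ω L α x := by
  obtain ⟨A, B, hA, hB, rfl⟩ := exists_sections_add hM hQ x v
  rw [map_add, hc.QL X B hX.of_subL hB]
  refine (subL Ω L α x).add_mem (mem_subL_of_forall hM hQ (hc.LL_mem A X hA hX.of_subL x)
    fun β hβ w hw ↦ ?_) ?_
  · obtain ⟨Y, hY, rfl⟩ := hQ.foliation.smooth.exists_section x hw
    have h0 : (fun y ↦ Ω β y (X y) (Y y)) = fun _ ↦ 0 :=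
      funext fun y ↦ (mem_subL_iff.1 (hX.2 y)).2 β hβ _
    rw [hc.LL A X hA hX.of_subL β Y hY, psi, h0, dirDeriv_const,
      (mem_subL_iff.1 (hX.2 x)).2 β hβ, sub_zero]
  · obtain ⟨a, ha, b, hb, hab⟩ := Submodule.mem_sup.1 (hQ.bracket α X B hX hB x)
    have : proj hQ.transversal (mlieBracket 𝓘(ℝ, E) B X) x = -a := by
      refine proj_eq _ ((L x).neg_mem (mem_subL_iff.1 ha).1) ((Q x).neg_mem hb) ?_
      rw [mlieBracket_swap_apply, ← hab, neg_add]
    rw [this]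
    exact (subL Ω L α x).neg_mem ha

/-- Along L this rearranges the formula `LL`. Along Q, `QQ` only tests against L_α, so X is split
into components: those in L_β with β ≠ α contribute 0 to every term, since ∇ preserves L_β. -/
lemma parallel_LQ (α : Fin k) {X Y : VF E M} (hX : IsSection L X) (hY : IsSection Q Y) (x : M)
    (v : TangentSpace 𝓘(ℝ, E) x) :
    dirDeriv (fun y ↦ Ω α y (X y) (Y y)) x v
      = Ω α x (cov X x v) (Y x) + Ω α x (X x) (cov Y x v) := by
  obtain ⟨A, B, hA, hB, rfl⟩ := exists_sections_add hM hQ x v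
  have h1 : dirDeriv (fun y ↦ Ω α y (X y) (Y y)) x (A x)
      = Ω α x (cov X x (A x)) (Y x) + Ω α x (X x) (cov Y x (A x)) := by
    rw [hc.LL A X hA hX α Y hY, hc.LQ A Y hA hY, form_proj_Q hQ hM (hX.2 x), psi]
    ring
  have hcomp : ∀ (β : Fin k) {X : VF E M}, IsSection (subL Ω L β) X →
      dirDeriv (fun y ↦ Ω α y (X y) (Y y)) x (B x)
        = Ω α x (cov X x (B x)) (Y x) + Ω α x (X x) (cov Y x (B x)) := by
    intro β X hX
    by_cases hβ : α = β
    · subst hβ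
      have e : (fun y ↦ Ω α y (X y) (Y y)) = fun y ↦ -Ω α y (Y y) (X y) :=
        funext fun y ↦ (hM.form α).neg_symm y _ _
      rw [e, dirDeriv_neg, (hM.form α).neg_symm x (X x), hc.QQ B Y hB hY α X hX,
        (hM.form α).neg_symm x _ (Y x), hc.QL X B hX.of_subL hB, form_proj_L hQ (hY.2 x), psi]
      ring
    · have h0 : (fun y ↦ Ω α y (X y) (Y y)) = fun _ ↦ 0 :=
        funext fun y ↦ (mem_subL_iff.1 (hX.2 y)).2 α hβ _
      rw [h0, dirDeriv_const, (mem_subL_iff.1 (hX.2 x)).2 α hβ,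
        (mem_subL_iff.1 (hc.mem_subL hM hQ hX x (B x))).2 α hβ, add_zero]
  have h2 : dirDeriv (fun y ↦ Ω α y (X y) (Y y)) x (B x)
      = Ω α x (cov X x (B x)) (Y x) + Ω α x (X x) (cov Y x (B x)) := by
    obtain ⟨Xc, hXc, rfl⟩ := exists_components hM hQ hX
    rw [linConn_sum cov _ (fun β ↦ (hXc β).1)]
    simp only [map_sum, sum_apply]
    rw [dirDeriv_sum _ (fun β ↦ (hM.form α).mdiffAt (hXc β).1 hY.1 x), ← Finset.sum_add_distrib]
    exact Finset.sum_congr rfl fun β _ ↦ hcomp β (hXc β)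
  rw [dirDeriv_add_right, h1, h2]
  simp only [map_add, add_apply]
  ring

/-- By isotropy only the mixed L–Q pairings survive, and ∇ preserves both summands, so `parallel_LQ`
is enough. -/
lemma parallel (α : Fin k) {W W' : VF E M} (hW : IsSmoothVF W) (hW' : IsSmoothVF W') (x : M)
    (v : TangentSpace 𝓘(ℝ, E) x) :
    dirDeriv (fun y ↦ Ω α y (W y) (W' y)) x v
      = Ω α x (cov W x v) (W' x) + Ω α x (W x) (cov W' x v) := by
  have split : ∀ V : VF E M, IsSmoothVF V → ∃ X Y, IsSection L X ∧ IsSection Q Y ∧ V = X + Y :=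
    fun V hV ↦ ⟨_, _, .proj_L hM hQ hV, .proj_Q hM hQ hV,
      funext fun y ↦ (proj_add_proj hQ.transversal V y).symm⟩
  obtain ⟨X, Y, hX, hY, rfl⟩ := split W hW
  obtain ⟨X', Y', hX', hY', rfl⟩ := split W' hW'
  have e : (fun y ↦ Ω α y ((X + Y) y) ((X' + Y') y))
      = fun y ↦ Ω α y (X y) (Y' y) - Ω α y (X' y) (Y y) := by
    funext y
    simp only [Pi.add_apply, map_add, add_apply, hM.isotropic α y _ (hX.2 y) _ (hX'.2 y),
      hQ.isotropic α y _ (hY.2 y) _ (hY'.2 y), (hM.form α).neg_symm y (Y y)]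
    ring
  rw [e, dirDeriv_sub ((hM.form α).mdiffAt hX.1 hY'.1 x) ((hM.form α).mdiffAt hX'.1 hY.1 x),
    hc.parallel_LQ hM hQ α hX hY', hc.parallel_LQ hM hQ α hX' hY,
    linConn_add cov hX.1 hY.1, linConn_add cov hX'.1 hY'.1]
  simp only [Pi.add_apply, map_add, add_apply,
    hM.isotropic α x _ (hc.mem_L hM hQ hX x v) _ (hX'.2 x),
    hM.isotropic α x _ (hX.2 x) _ (hc.mem_L hM hQ hX' x v),
    hQ.isotropic α x _ (hY.2 x) _ (hc.mem_Q hM hQ hY' x v),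
    hQ.isotropic α x _ (hc.mem_Q hM hQ hY x v) _ (hY'.2 x),
    (hM.form α).neg_symm x (Y x), (hM.form α).neg_symm x (cov Y x v)]
  ring

lemma isCanonicalConnection (hs : IsSmoothConn cov) : IsCanonicalConnection Ω L Q cov where
  smooth := hs
  preserves_subL _ _ hX x v := hc.mem_subL hM hQ hX x v
  preserves_Q _ hY x v := hc.mem_Q hM hQ hY x v
  parallel α _ _ hW hW' x v := hc.parallel hM hQ α hW hW' x v
  torsion x u hu v hv := by
    obtain ⟨X, hX, rfl⟩ := hM.foliation.smooth.exists_section x hu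
    obtain ⟨Y, hY, rfl⟩ := hQ.foliation.smooth.exists_section x hv
    rw [cov.torsion_apply (hX.1.mdiffAt x) (hY.1.mdiffAt x), hc.LQ X Y hX hY, hc.QL X Y hX hY]
    have h := proj_add_proj hQ.transversal (mlieBracket 𝓘(ℝ, E) X Y) x
    have e : proj hQ.transversal (mlieBracket 𝓘(ℝ, E) Y X) x
        = -proj hQ.transversal (mlieBracket 𝓘(ℝ, E) X Y) x := by
      rw [mlieBracket_swap]; simp [proj]
    rw [e, sub_neg_eq_add, sub_eq_zero, add_comm, h]

end IsAdaptedConn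

include hM in
-- The torsion identity separates into its L- and Q-parts and gives the mixed derivatives; inserting
-- these into the parallelism of the forms gives the other two.
lemma IsCanonicalConnection.isAdaptedConn (hc : IsCanonicalConnection Ω L Q cov) :
    IsAdaptedConn Ω L Q hQ.transversal cov := by
  have memL : ∀ X : VF E M, IsSection L X → ∀ x v, cov X x v ∈ L x := by
    intro X hX x v
    obtain ⟨Xc, hXc, rfl⟩ := exists_components hM hQ hX
    rw [linConn_sum cov _ fun β ↦ (hXc β).1]
    exact Submodule.sum_mem _ fun β _ ↦
      (mem_subL_iff.1 (hc.preserves_subL β (Xc β) (hXc β) x v)).1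
  have tors : ∀ X Y : VF E M, IsSection L X → IsSection Q Y → ∀ x,
      mlieBracket 𝓘(ℝ, E) X Y x = cov Y x (X x) - cov X x (Y x) := by
    intro X Y hX hY x
    have h := hc.torsion x _ (hX.2 x) _ (hY.2 x)
    rw [cov.torsion_apply (hX.1.mdiffAt x) (hY.1.mdiffAt x), sub_eq_zero] at h
    exact h.symm
  have QL : ∀ X Y : VF E M, IsSection L X → IsSection Q Y → ∀ x,
      cov X x (Y x) = proj hQ.transversal (mlieBracket 𝓘(ℝ, E) Y X) x := by
    intro X Y hX hY x
    refine (proj_eq _ (memL X hX x _) ((Q x).neg_mem (hc.preserves_Q Y hY x (X x))) ?_).symm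
    rw [mlieBracket_swap_apply, tors X Y hX hY]; abel
  have LQ : ∀ X Y : VF E M, IsSection L X → IsSection Q Y → ∀ x,
      cov Y x (X x) = proj (fun x ↦ (hQ.transversal x).symm) (mlieBracket 𝓘(ℝ, E) X Y) x := by
    intro X Y hX hY x
    refine (proj_eq _ (hc.preserves_Q Y hY x (X x)) ((L x).neg_mem (memL X hX x (Y x))) ?_).symm
    rw [tors X Y hX hY, sub_eq_add_neg]
  refine ⟨fun X X' _ hX' x ↦ memL X' hX' x _, fun X X' hX hX' α Y hY x ↦ ?_,
    fun Y Y' _ hY' x ↦ hc.preserves_Q Y' hY' x _, fun Y Y' hY hY' α X hX x ↦ ?_, QL, LQ⟩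
  · have h := hc.parallel α X' Y hX'.1 hY.1 x (X x)
    rw [LQ X Y hX hY, form_proj_Q hQ hM (hX'.2 x)] at h
    rw [psi, h]; ring
  · have h := hc.parallel α Y' X hY'.1 hX.1 x (Y x)
    rw [QL X Y hX.of_subL hY, form_proj_L hQ (hY'.2 x)] at h
    rw [psi, h]; ring

include hM in
lemma IsAdaptedConn.unique {cov' : LinConn E M} (hc : IsAdaptedConn Ω L Q hQ.transversal cov)
    (hc' : IsAdaptedConn Ω L Q hQ.transversal cov') {W : VF E M} (hW : IsSmoothVF W) (x : M) :
    cov' W x = cov W x := by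
  have e : W = proj hQ.transversal W + proj (fun x ↦ (hQ.transversal x).symm) W :=
    funext fun y ↦ (proj_add_proj hQ.transversal W y).symm
  have hX := IsSection.proj_L hM hQ hW
  have hY := IsSection.proj_Q hM hQ hW
  rw [e, linConn_add _ hX.1 hY.1, linConn_add _ hX.1 hY.1]
  ext v
  obtain ⟨A, B, hA, hB, rfl⟩ := exists_sections_add hM hQ x v
  have h1 : cov' (proj hQ.transversal W) x (A x) = cov (proj hQ.transversal W) x (A x) := by
    refine eq_of_mem_L hM hQ (hc'.LL_mem _ _ hA hX x) (hc.LL_mem _ _ hA hX x) fun α w hw ↦ ?_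
    obtain ⟨Y, hY, rfl⟩ := hQ.foliation.smooth.exists_section x hw
    rw [hc'.LL _ _ hA hX α Y hY, hc.LL _ _ hA hX α Y hY]
  have h2 : cov' (proj (fun x ↦ (hQ.transversal x).symm) W) x (B x)
      = cov (proj (fun x ↦ (hQ.transversal x).symm) W) x (B x) := by
    refine sub_eq_zero.1 (eq_zero_of_mem_Q' hM hQ ((Q x).sub_mem (hc'.QQ_mem _ _ hB hY x)
      (hc.QQ_mem _ _ hB hY x)) fun α w hw ↦ ?_)
    obtain ⟨Z, hZ, rfl⟩ := exists_section_subL hM hQ α x hw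
    rw [map_sub, sub_apply, hc'.QQ _ _ hB hY α Z hZ, hc.QQ _ _ hB hY α Z hZ, sub_self]
  simp only [add_apply, map_add, h1, h2, hc'.QL _ _ hX hB, hc.QL _ _ hX hB, hc'.LQ _ _ hA hY,
    hc.LQ _ _ hA hY]

section Flat

variable (hc : IsAdaptedConn Ω L Q hQ.transversal cov) (hs : IsSmoothConn cov)
include hM hc hs

/-- On Q the derivative along L is a projected bracket, hence flat. For Z in L, R Z stays in L and
Ω_α(R Z, Y) = -Ω_α(Z, R Y) = 0 for all Y in Q, so R Z = 0. -/
lemma curvature_L {X X' V : VF E M} (hX : IsSection L X) (hX' : IsSection L X')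
    (hV : IsSmoothVF V) (x : M) : curvature cov X X' V x = 0 := by
  have hQ0 : ∀ Y, IsSection Q Y → ∀ x, curvature cov X X' Y x = 0 := fun Y hY x ↦
    curvature_eq_zero_of_bracket hQ.transversal hM.foliation.involutive
      (fun _ h ↦ .proj_L hM hQ h) (fun _ h ↦ .proj_Q hM hQ h) hc.LQ hX hX' hY x
  have hL0 : ∀ Z, IsSection L Z → curvature cov X X' Z x = 0 := fun Z hZ ↦ by
    refine eq_zero_of_mem_L hM hQ ?_ fun α w hw ↦ ?_
    · exact (L x).sub_mem ((L x).sub_mem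
        (hc.mem_L hM hQ ⟨hs.smoothVF hX'.1 hZ.1, fun y ↦ hc.mem_L hM hQ hZ y _⟩ x _)
        (hc.mem_L hM hQ ⟨hs.smoothVF hX.1 hZ.1, fun y ↦ hc.mem_L hM hQ hZ y _⟩ x _))
        (hc.mem_L hM hQ hZ x _)
    · obtain ⟨Y, hY, rfl⟩ := hQ.foliation.smooth.exists_section x hw
      rw [curvature_skew hs (hM.form α) (fun _ _ h h' ↦ hc.parallel hM hQ α h h') hX.1 hX'.1 hZ.1
        hY.1, hQ0 Y hY, map_zero, neg_zero]
  have e : V = proj hQ.transversal V + proj (fun x ↦ (hQ.transversal x).symm) V :=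
    funext fun y ↦ (proj_add_proj hQ.transversal V y).symm
  have h1 := IsSection.proj_L hM hQ hV
  have h2 := IsSection.proj_Q hM hQ hV
  rw [e, curvature_add hs hX.1 hX'.1 h1.1 h2.1, hQ0 _ h2, hL0 _ h1, add_zero]

lemma curvature_Q {Y Y' V : VF E M} (hY : IsSection Q Y) (hY' : IsSection Q Y')
    (hV : IsSmoothVF V) (x : M) : curvature cov Y Y' V x = 0 := by
  have hL0 : ∀ X, IsSection L X → ∀ x, curvature cov Y Y' X x = 0 := fun X hX x ↦
    curvature_eq_zero_of_bracket (fun x ↦ (hQ.transversal x).symm) hQ.foliation.involutive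
      (fun _ h ↦ .proj_Q hM hQ h) (fun _ h ↦ .proj_L hM hQ h)
      (fun A B hA hB ↦ hc.QL B A hB hA) hY hY' hX x
  have hQ0 : ∀ Z, IsSection Q Z → curvature cov Y Y' Z x = 0 := fun Z hZ ↦ by
    refine eq_zero_of_mem_Q' hM hQ ?_ fun α w hw ↦ ?_
    · exact (Q x).sub_mem ((Q x).sub_mem
        (hc.mem_Q hM hQ ⟨hs.smoothVF hY'.1 hZ.1, fun y ↦ hc.mem_Q hM hQ hZ y _⟩ x _)
        (hc.mem_Q hM hQ ⟨hs.smoothVF hY.1 hZ.1, fun y ↦ hc.mem_Q hM hQ hZ y _⟩ x _))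
        (hc.mem_Q hM hQ hZ x _)
    · obtain ⟨X, hX, rfl⟩ := exists_section_subL hM hQ α x hw
      rw [curvature_skew hs (hM.form α) (fun _ _ h h' ↦ hc.parallel hM hQ α h h') hY.1 hY'.1 hZ.1
        hX.1, hL0 X hX.of_subL, map_zero, neg_zero]
  have e : V = proj hQ.transversal V + proj (fun x ↦ (hQ.transversal x).symm) V :=
    funext fun y ↦ (proj_add_proj hQ.transversal V y).symm
  have h1 := IsSection.proj_L hM hQ hV
  have h2 := IsSection.proj_Q hM hQ hV
  rw [e, curvature_add hs hY.1 hY'.1 h1.1 h2.1, hQ0 _ h2, hL0 _ h1, add_zero]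

end Flat

include hM hQ in
-- With Ω_α(X, X') = 0, the equation dΩ_α(X, X', Y) = 0 reads ψ_α^{X X'}(Y) - ψ_α^{X' X}(Y) =
-- Ω_α([X, X'], Y), and by involutivity both sides come from vectors in L.
lemma torsion_L (hc : IsAdaptedConn Ω L Q hQ.transversal cov) {X X' : VF E M} (hX : IsSection L X)
    (hX' : IsSection L X') (x : M) :
    cov X' x (X x) - cov X x (X' x) = mlieBracket 𝓘(ℝ, E) X X' x := by
  refine eq_of_mem_L hM hQ ((L x).sub_mem (hc.LL_mem X X' hX hX' x) (hc.LL_mem X' X hX' hX x))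
    (hM.foliation.involutive X X' hX hX' x) fun α w hw ↦ ?_
  obtain ⟨Y, hY, rfl⟩ := hQ.foliation.smooth.exists_section x hw
  have h := (hM.form α).closed X X' Y hX.1 hX'.1 hY.1 x
  have h0 : (fun y ↦ Ω α y (X y) (X' y)) = fun _ ↦ 0 :=
    funext fun y ↦ hM.isotropic α y _ (hX.2 y) _ (hX'.2 y)
  rw [h0, dirDeriv_const, (hM.form α).neg_symm x (mlieBracket 𝓘(ℝ, E) X Y x),
    (hM.form α).neg_symm x (mlieBracket 𝓘(ℝ, E) X' Y x)] at h
  rw [map_sub, sub_apply, hc.LL X X' hX hX' α Y hY, hc.LL X' X hX' hX α Y hY, psi, psi]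
  linarith

include hM hQ in
lemma torsion_Q (hc : IsAdaptedConn Ω L Q hQ.transversal cov) {Y Y' : VF E M} (hY : IsSection Q Y)
    (hY' : IsSection Q Y') (x : M) :
    cov Y' x (Y x) - cov Y x (Y' x) = mlieBracket 𝓘(ℝ, E) Y Y' x := by
  refine sub_eq_zero.1 (eq_zero_of_mem_Q' hM hQ ((Q x).sub_mem ((Q x).sub_mem
    (hc.QQ_mem Y Y' hY hY' x) (hc.QQ_mem Y' Y hY' hY x))
    (hQ.foliation.involutive Y Y' hY hY' x)) fun α w hw ↦ ?_)
  obtain ⟨X, hX, rfl⟩ := exists_section_subL hM hQ α x hw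
  have h := (hM.form α).closed Y Y' X hY.1 hY'.1 hX.1 x
  have h0 : (fun y ↦ Ω α y (Y y) (Y' y)) = fun _ ↦ 0 :=
    funext fun y ↦ hQ.isotropic α y _ (hY.2 y) _ (hY'.2 y)
  rw [h0, dirDeriv_const, (hM.form α).neg_symm x (mlieBracket 𝓘(ℝ, E) Y X x),
    (hM.form α).neg_symm x (mlieBracket 𝓘(ℝ, E) Y' X x)] at h
  rw [map_sub, map_sub, sub_apply, sub_apply, hc.QQ Y Y' hY hY' α X hX, hc.QQ Y' Y hY' hY α X hX,
    psi, psi]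
  linarith

end Canonical

/-! ### Coordinates, and local extension of functions from immersed manifolds. -/

section Submanifold

variable {E : Type*} [NormedAddCommGroup E] [NormedSpace ℝ E] [FiniteDimensional ℝ E]
  {M : Type*} [TopologicalSpace M] [T2Space M] [ChartedSpace E M] [IsManifold 𝓘(ℝ, E) ∞ M]

variable (E) in
/-- Near a point, tangent vectors are expressed by the differentials of smooth functions. -/
lemma exists_coordinates (x : M) : ∃ (ξ : Fin (Module.finrank ℝ E) → M → ℝ)
    (b : Fin (Module.finrank ℝ E) → VF E M), (∀ i, SmoothFn (E := E) (ξ i)) ∧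
    (∀ i, IsSmoothVF (b i)) ∧ ∀ᶠ y in 𝓝 x, ∀ v : TangentSpace 𝓘(ℝ, E) y,
      ∑ i, dirDeriv (ξ i) y v • b i y = v := by
  let e := trivializationAt E (TangentSpace 𝓘(ℝ, E) : M → Type _) x
  have hx : x ∈ e.baseSet := FiberBundle.mem_baseSet_trivializationAt' x
  obtain ⟨χ, h1, h2, h3, h4⟩ := exists_bump_smul (E := E) e.open_baseSet hx
  let β := Module.finBasis ℝ E
  let φ := extChartAt 𝓘(ℝ, E) x
  have hsrc : φ.source = (chartAt E x).source := extChartAt_source _ _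
  have hopen : IsOpen φ.source := isOpen_extChartAt_source x
  obtain ⟨χ', h1', h2', h3'⟩ := exists_bump (E := E) (hopen.mem_nhds (mem_extChartAt_source x))
  have hl : ∀ i, ContMDiff 𝓘(ℝ, E) 𝓘(ℝ, ℝ) ∞ (LinearMap.toContinuousLinearMap (β.coord i)) :=
    fun i ↦ ContinuousLinearMap.contMDiff _
  refine ⟨fun i y ↦ χ' y * β.coord i (φ y), fun i ↦ χ • e.localFrame β i, fun i ↦
    h1'.mul_of_tsupport hopen h3' ((hl i).comp_contMDiffOn (contMDiffOn_extChartAt.mono hsrc.le)),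
    fun i ↦ h4 _ (e.contMDiffOn_localFrame_baseSet _ β i), ?_⟩
  filter_upwards [h2, h2'.eventuallyEq_nhds, hopen.mem_nhds (mem_extChartAt_source x),
    e.open_baseSet.mem_nhds hx] with y hy hy' hys hye v
  have hy1 : χ y = 1 := hy
  have hφ : MDifferentiableAt 𝓘(ℝ, E) 𝓘(ℝ, E) φ y :=
    mdifferentiableAt_extChartAt (hsrc ▸ hys)
  have hd : ∀ i, dirDeriv (fun y ↦ χ' y * β.coord i (φ y)) y v
      = β.coord i (e.continuousLinearMapAt ℝ y v) := fun i ↦ by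
    have hc : (fun y ↦ χ' y * β.coord i (φ y)) =ᶠ[𝓝 y]
        fun y ↦ LinearMap.toContinuousLinearMap (β.coord i) (φ y) := by
      filter_upwards [hy'] with z hz using by simp [hz]
    have h5 := ((LinearMap.toContinuousLinearMap (β.coord i)).hasMFDerivAt (x := φ y)).comp y
      hφ.hasMFDerivAt
    -- The tangent bundle is trivialized by the differential of the chart, so the differentials of
    -- the chart coordinates are dual to the local frame.
    rw [dirDeriv_congr hc, TangentBundle.continuousLinearMapAt_trivializationAt (hsrc ▸ hys)]
    exact congrArg (fun l : E →L[ℝ] ℝ ↦ l v) h5.mfderiv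
  simp only [hd, Pi.smul_apply', hy1, one_smul]
  have hb : ∀ i, e.localFrame β i y = (e.continuousLinearEquivAt ℝ y hye).symm (β i) := fun i ↦ by
    rw [e.localFrame_apply_of_mem_baseSet β hye]; rfl
  have h6 : e.continuousLinearMapAt ℝ y v = e.continuousLinearEquivAt ℝ y hye v := by
    rw [e.coe_continuousLinearEquivAt_eq hye]
  simp only [hb, h6, Module.Basis.coord_apply, ← map_smul, ← map_sum]
  rw [β.sum_repr, ContinuousLinearEquiv.symm_apply_apply]

variable {F : Type*} [NormedAddCommGroup F] [NormedSpace ℝ F] [FiniteDimensional ℝ F]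
  {N : Type*} [TopologicalSpace N] [ChartedSpace F N] [IsManifold 𝓘(ℝ, F) ∞ N] {ι : N → M}

/-- Smooth functions on an immersed manifold extend locally to the ambient manifold. -/
lemma exists_extension (hι : ContMDiff 𝓘(ℝ, F) 𝓘(ℝ, E) ∞ ι) {p : N}
    (hi : Function.Injective (mfderiv 𝓘(ℝ, F) 𝓘(ℝ, E) ι p)) {f : N → ℝ}
    (hf : SmoothFn (E := F) f) :
    ∃ g : M → ℝ, SmoothFn (E := E) g ∧ ∀ᶠ q in 𝓝 p, g (ι q) = f q := by
  let φ := extChartAt 𝓘(ℝ, F) p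
  let ψ := extChartAt 𝓘(ℝ, E) (ι p)
  let G : F → E := writtenInExtChartAt 𝓘(ℝ, F) 𝓘(ℝ, E) p ι
  have hψo : IsOpen ψ.source := isOpen_extChartAt_source (ι p)
  have hφo : IsOpen φ.source := isOpen_extChartAt_source p
  have hφt : IsOpen φ.target := isOpen_extChartAt_target p
  have hψs : ContMDiffOn 𝓘(ℝ, E) 𝓘(ℝ, E) ∞ ψ ψ.source :=
    contMDiffOn_extChartAt.mono (extChartAt_source _ _).le
  have hφs : ContMDiffOn 𝓘(ℝ, F) 𝓘(ℝ, F) ∞ φ.symm φ.target := contMDiffOn_extChartAt_symm p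
  have hφc : ContinuousAt φ p := continuousAt_extChartAt p
  let W : Set F := φ.target ∩ φ.symm ⁻¹' (ι ⁻¹' ψ.source)
  have hW : IsOpen W :=
    hφs.continuousOn.isOpen_inter_preimage hφt (hψo.preimage hι.continuous)
  have hpW : φ p ∈ W := ⟨mem_extChartAt_target p, by
    simp only [Set.mem_preimage, φ, extChartAt_to_inv]; exact mem_extChartAt_source (ι p)⟩
  have hG : ContDiffOn ℝ ∞ G W := by
    rw [← contMDiffOn_iff_contDiffOn]
    exact hψs.comp ((hι.contMDiffOn (s := Set.univ)).comp (hφs.mono Set.inter_subset_left)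
      fun _ _ ↦ Set.mem_univ _) fun z hz ↦ hz.2
  have hGp : HasFDerivAt G (mfderiv 𝓘(ℝ, F) 𝓘(ℝ, E) ι p : F →L[ℝ] E) (φ p) := by
    have h := (hι.mdifferentiable (by simp) p).hasMFDerivAt.2
    rw [𝓘(ℝ, F).range_eq_univ] at h
    exact hasFDerivWithinAt_univ.1 h
  -- Composing ι in charts with a linear left inverse of its differential gives a self-map H of F
  -- with derivative the identity at p. Its local inverse turns A ∘ ψ into a smooth left inverse of
  -- ι in charts.
  obtain ⟨A₀, hA₀⟩ := LinearMap.exists_leftInverse_of_injective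
    (mfderiv 𝓘(ℝ, F) 𝓘(ℝ, E) ι p : F →L[ℝ] E).toLinearMap (LinearMap.ker_eq_bot.2 hi)
  let A : E →L[ℝ] F := LinearMap.toContinuousLinearMap A₀
  let H : F → F := fun z ↦ A (G z)
  have hH : ContDiffOn ℝ ∞ H W := A.contDiff.comp_contDiffOn hG
  have hHz : ∀ z ∈ W, ContDiffAt ℝ ∞ H z := fun z hz ↦ hH.contDiffAt (hW.mem_nhds hz)
  have hHp : HasFDerivAt H ((ContinuousLinearEquiv.refl ℝ F : F ≃L[ℝ] F) : F →L[ℝ] F) (φ p) := by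
    refine HasFDerivAt.congr_fderiv (A.hasFDerivAt.comp (φ p) hGp) ?_
    ext v
    exact congrArg (fun l : F →ₗ[ℝ] F ↦ l v) hA₀
  let e := (hHz _ hpW).toOpenPartialHomeomorph H hHp (by simp)
  have heH : (e : F → F) = H := (hHz _ hpW).toOpenPartialHomeomorph_coe hHp (by simp)
  have hpe : φ p ∈ e.source := (hHz _ hpW).mem_toOpenPartialHomeomorph_source hHp (by simp)
  -- Smoothness of the inverse of H is needed on an open set, so the derivative of H must be
  -- invertible at all nearby points.
  have hinv : ∀ᶠ z in 𝓝 (φ p), fderiv ℝ H z ∈ Set.range ((↑) : (F ≃L[ℝ] F) → F →L[ℝ] F) := by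
    refine ((hHz _ hpW).continuousAt_fderiv (by simp)).eventually_mem
      (ContinuousLinearEquiv.isOpen.mem_nhds ?_)
    rw [hHp.fderiv]; exact ⟨_, rfl⟩
  obtain ⟨W', hW'i, hW', hpW'⟩ := eventually_nhds_iff.1
    (hinv.and ((hW.eventually_mem hpW).and (e.open_source.eventually_mem hpe)))
  let V : Set F := e.target ∩ e.symm ⁻¹' W'
  have hV : IsOpen V := e.symm.isOpen_inter_preimage hW'
  have hVs : ContMDiffOn 𝓘(ℝ, F) 𝓘(ℝ, F) ∞ e.symm V := by
    rw [contMDiffOn_iff_contDiffOn]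
    intro z hz
    obtain ⟨⟨l, hl⟩, h2, h3⟩ := hW'i _ hz.2
    refine (e.contDiffAt_symm (f₀' := l) hz.1 ?_ (heH ▸ hHz _ h2)).contDiffWithinAt
    rw [hl, heH]
    exact ((hHz _ h2).differentiableAt (by simp)).hasFDerivAt
  let U : Set M := ψ.source ∩ ψ ⁻¹' (A ⁻¹' V)
  have hU : IsOpen U := hψs.continuousOn.isOpen_inter_preimage hψo (hV.preimage A.continuous)
  have key : ∀ q ∈ φ.source, φ q ∈ W' → ι q ∈ U ∧ e.symm (A (ψ (ι q))) = φ q := by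
    intro q hq hqW
    have h1 : A (ψ (ι q)) = e (φ q) := by
      rw [heH]
      simp only [H, G, writtenInExtChartAt, Function.comp_apply]
      rw [φ.left_inv hq]
    have h2 := hW'i _ hqW
    have h3 : e.symm (A (ψ (ι q))) = φ q := by rw [h1, e.left_inv h2.2.2]
    refine ⟨⟨?_, ?_, ?_⟩, h3⟩
    · have := h2.2.1.2
      rwa [Set.mem_preimage, φ.left_inv hq] at this
    · rw [h1]; exact e.map_source h2.2.2
    · rw [Set.mem_preimage, h3]; exact hqW
  have hpU : ι p ∈ U := (key p (mem_extChartAt_source p) hpW').1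
  obtain ⟨χ, h1, h2, h3⟩ := exists_bump (E := E) (hU.mem_nhds hpU)
  refine ⟨fun y ↦ χ y * f (φ.symm (e.symm (A (ψ y)))), h1.mul_of_tsupport hU h3 ?_, ?_⟩
  · refine (hf.contMDiffOn (s := Set.univ)).comp (hφs.comp (hVs.comp
      (A.contMDiff.comp_contMDiffOn (hψs.mono Set.inter_subset_left)) fun y hy ↦ hy.2)
      fun y hy ↦ ?_) fun _ _ ↦ Set.mem_univ _
    exact (hW'i _ hy.2.2).2.1.1
  · filter_upwards [hι.continuous.continuousAt.eventually h2,
      hφo.mem_nhds (mem_extChartAt_source p),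
      hφc.eventually_mem (hW'.mem_nhds hpW')] with q hq1 hq2 hq3
    have hq1' : χ (ι q) = 1 := hq1
    rw [hq1', one_mul, (key q hq2 hq3).2, φ.left_inv hq2]

end Submanifold

/-! ### Vector fields related by an immersion. -/

section Related

variable {E : Type*} [NormedAddCommGroup E] [NormedSpace ℝ E] [FiniteDimensional ℝ E]
  {M : Type*} [TopologicalSpace M] [T2Space M] [ChartedSpace E M] [IsManifold 𝓘(ℝ, E) ∞ M]
  {F : Type*} [NormedAddCommGroup F] [NormedSpace ℝ F] [FiniteDimensional ℝ F]
  {N : Type*} [TopologicalSpace N] [ChartedSpace F N] [IsManifold 𝓘(ℝ, F) ∞ N]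

/-- The vector fields `Z` on `N` and `W` on `M` are `ι`-related near `p`. -/
def RelatedAt (ι : N → M) (p : N) (Z : VF F N) (W : VF E M) : Prop :=
  ∀ᶠ q in 𝓝 p, mfderiv 𝓘(ℝ, F) 𝓘(ℝ, E) ι q (Z q) = W (ι q)

variable {ι : N → M} {p : N}

omit [FiniteDimensional ℝ E] [T2Space M] [FiniteDimensional ℝ F] [IsManifold 𝓘(ℝ, E) ∞ M]
  [IsManifold 𝓘(ℝ, F) ∞ N] in
lemma dirDeriv_comp (hι : ContMDiff 𝓘(ℝ, F) 𝓘(ℝ, E) ∞ ι) {g : M → ℝ} (hg : SmoothFn (E := E) g)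
    (q : N) (u : TangentSpace 𝓘(ℝ, F) q) :
    dirDeriv (fun q ↦ g (ι q)) q u = dirDeriv g (ι q) (mfderiv 𝓘(ℝ, F) 𝓘(ℝ, E) ι q u) :=
  congrArg (fun l : F →L[ℝ] ℝ ↦ l u)
    (mfderiv_comp q (hg.mdiffAt (ι q)) (hι.mdifferentiable (by simp) q))

namespace RelatedAt

variable {Z Z' : VF F N} {W W' : VF E M}

omit [FiniteDimensional ℝ E] [T2Space M] [FiniteDimensional ℝ F] [IsManifold 𝓘(ℝ, E) ∞ M]
  [IsManifold 𝓘(ℝ, F) ∞ N] in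
lemma add (h : RelatedAt ι p Z W) (h' : RelatedAt ι p Z' W') :
    RelatedAt ι p (Z + Z') (W + W') := by
  filter_upwards [h, h'] with q hq hq'
  rw [Pi.add_apply, Pi.add_apply, map_add, hq, hq']

omit [FiniteDimensional ℝ E] [T2Space M] [FiniteDimensional ℝ F] [IsManifold 𝓘(ℝ, E) ∞ M]
  [IsManifold 𝓘(ℝ, F) ∞ N] in
lemma smul {f : N → ℝ} {g : M → ℝ} (h : RelatedAt ι p Z W) (hfg : ∀ᶠ q in 𝓝 p, g (ι q) = f q) :
    RelatedAt ι p (f • Z) (g • W) := by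
  filter_upwards [h, hfg] with q hq hq'
  rw [Pi.smul_apply', Pi.smul_apply', map_smul, hq, hq']

/-- Both sides are tested on smooth functions, where brackets are commutators of derivations and
relatedness is the chain rule. -/
lemma mlieBracket [T2Space N] (hι : ContMDiff 𝓘(ℝ, F) 𝓘(ℝ, E) ∞ ι) (hZ : IsSmoothVF Z)
    (hZ' : IsSmoothVF Z') (hW : IsSmoothVF W) (hW' : IsSmoothVF W')
    (h : RelatedAt ι p Z W) (h' : RelatedAt ι p Z' W') :
    mfderiv 𝓘(ℝ, F) 𝓘(ℝ, E) ι p (VectorField.mlieBracket 𝓘(ℝ, F) Z Z' p)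
      = VectorField.mlieBracket 𝓘(ℝ, E) W W' (ι p) := by
  refine sub_eq_zero.1 (eq_zero_of_dirDeriv_eq_zero fun f hf ↦ ?_)
  have hfι : SmoothFn (E := F) (fun q ↦ f (ι q)) := hf.comp hι
  have aux : ∀ {X : VF F N} {V : VF E M}, RelatedAt ι p X V →
      (fun q ↦ dirDeriv (fun q ↦ f (ι q)) q (X q)) =ᶠ[𝓝 p]
        fun q ↦ (fun y ↦ dirDeriv f y (V y)) (ι q) := fun {X V} hX ↦ by
    filter_upwards [hX] with q hq
    rw [dirDeriv_comp hι hf, hq]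
  rw [dirDeriv_sub_right, ← dirDeriv_comp hι hf, dirDeriv_mlieBracket hfι hZ hZ',
    dirDeriv_mlieBracket hf hW hW', dirDeriv_congr (aux h), dirDeriv_congr (aux h'),
    dirDeriv_comp hι (hf.dirDeriv hW), dirDeriv_comp hι (hf.dirDeriv hW'), h.self_of_nhds,
    h'.self_of_nhds, sub_self]

end RelatedAt

/-- A vector field on `N` that is locally related to smooth vector fields is smooth. -/
lemma isSmoothVF_of_relatedAt [T2Space N] (hι : ContMDiff 𝓘(ℝ, F) 𝓘(ℝ, E) ∞ ι)
    (hi : ∀ p, Function.Injective (mfderiv 𝓘(ℝ, F) 𝓘(ℝ, E) ι p)) {Z : VF F N}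
    (h : ∀ p, ∃ W : VF E M, IsSmoothVF W ∧ RelatedAt ι p Z W) : IsSmoothVF Z := by
  refine isSmoothVF_of_eventuallyEq fun p ↦ ?_
  obtain ⟨W, hW, hZW⟩ := h p
  obtain ⟨ξ, b, hξ, hb, hξb⟩ := exists_coordinates F p
  -- With the coordinates of N extended to M, the components of Z are the functions dg_i(W) composed
  -- with ι, which are smooth.
  choose g hg hgξ using fun i ↦ exists_extension hι (hi p) (hξ i)
  refine ⟨fun q ↦ ∑ i, dirDeriv (g i) (ι q) (W (ι q)) • b i q,
    IsSmoothVF.sum (X := fun i ↦ (fun q ↦ dirDeriv (g i) (ι q) (W (ι q))) • b i)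
      fun i _ ↦ (hb i).smul (((hg i).dirDeriv hW).comp hι), ?_⟩
  filter_upwards [hξb, hZW, Filter.eventually_all.2 fun i ↦ (hgξ i).eventually_nhds]
    with q h1 h2 h3
  conv_lhs => rw [← h1 (Z q)]
  refine Finset.sum_congr rfl fun i _ ↦ ?_
  rw [← h2, ← dirDeriv_comp hι (hg i), dirDeriv_congr (h3 i)]

/-- A smooth vector field on `N` is locally related to a smooth vector field on `M`. -/
lemma exists_relatedAt (hι : ContMDiff 𝓘(ℝ, F) 𝓘(ℝ, E) ∞ ι)
    (hi : Function.Injective (mfderiv 𝓘(ℝ, F) 𝓘(ℝ, E) ι p)) {Z : VF F N} (hZ : IsSmoothVF Z) :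
    ∃ W : VF E M, IsSmoothVF W ∧ RelatedAt ι p Z W := by
  obtain ⟨ξ, b, hξ, hb, hξb⟩ := exists_coordinates E (ι p)
  -- The ambient components of dι Z are smooth functions on N; extending each of them to M gives the
  -- coefficients of W.
  choose g hg hgξ using fun i ↦ exists_extension (p := p) hι hi
    (SmoothFn.dirDeriv (((hξ i).comp hι : SmoothFn (E := F) (fun q ↦ ξ i (ι q)))) hZ)
  refine ⟨fun y ↦ ∑ i, g i y • b i y,
    IsSmoothVF.sum (X := fun i ↦ g i • b i) fun i _ ↦ (hb i).smul (hg i), ?_⟩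
  filter_upwards [hι.continuous.continuousAt.eventually hξb, Filter.eventually_all.2 hgξ]
    with q h1 h2
  conv_lhs => rw [← h1 (mfderiv 𝓘(ℝ, F) 𝓘(ℝ, E) ι q (Z q))]
  refine Finset.sum_congr rfl fun i _ ↦ ?_
  rw [h2, ← dirDeriv_comp hι (hξ i)]
  rfl

omit [FiniteDimensional ℝ F] [IsManifold 𝓘(ℝ, F) ∞ N] in
/-- The covariant derivative of `W` along `ι` depends only on the values of `W` along `ι`. -/
lemma linConn_eq_of_eq_comp (cov : LinConn E M) (hι : ContMDiff 𝓘(ℝ, F) 𝓘(ℝ, E) ∞ ι)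
    {W W' : VF E M} (hW : IsSmoothVF W) (hW' : IsSmoothVF W')
    (h : ∀ᶠ q in 𝓝 p, W (ι q) = W' (ι q)) (u : TangentSpace 𝓘(ℝ, F) p) :
    cov W (ι p) (mfderiv 𝓘(ℝ, F) 𝓘(ℝ, E) ι p u)
      = cov W' (ι p) (mfderiv 𝓘(ℝ, F) 𝓘(ℝ, E) ι p u) := by
  obtain ⟨ξ, b, hξ, hb, hξb⟩ := exists_coordinates E (ι p)
  -- Expanding V in a frame, the derivative along dι u only involves the components of V composed
  -- with ι.
  have key : ∀ V : VF E M, IsSmoothVF V → cov V (ι p) (mfderiv 𝓘(ℝ, F) 𝓘(ℝ, E) ι p u)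
      = ∑ i, (dirDeriv (ξ i) (ι p) (V (ι p)) • cov (b i) (ι p) (mfderiv 𝓘(ℝ, F) 𝓘(ℝ, E) ι p u)
        + dirDeriv (fun q ↦ dirDeriv (ξ i) (ι q) (V (ι q))) p u • b i (ι p)) := fun V hV ↦ by
    have hs : ∀ i, IsSmoothVF ((fun y ↦ dirDeriv (ξ i) y (V y)) • b i) := fun i ↦
      (hb i).smul ((hξ i).dirDeriv hV)
    have e := linConn_congr cov (x := ι p) hV (IsSmoothVF.sum (s := Finset.univ) fun i _ ↦ hs i)
      (hξb.mono fun y hy ↦ (hy (V y)).symm)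
    rw [e, linConn_sum cov _ hs]
    refine Finset.sum_congr rfl fun i _ ↦ ?_
    rw [linConn_smul cov ((hξ i).dirDeriv hV) (hb i), dirDeriv_comp hι ((hξ i).dirDeriv hV)]
  rw [key W hW, key W' hW']
  refine Finset.sum_congr rfl fun i _ ↦ ?_
  have h1 : (fun q ↦ dirDeriv (ξ i) (ι q) (W (ι q))) =ᶠ[𝓝 p]
      fun q ↦ dirDeriv (ξ i) (ι q) (W' (ι q)) := by
    filter_upwards [h] with q hq using by rw [hq]
  rw [h.self_of_nhds, dirDeriv_congr h1]

end Related

/-! ### Restriction of a connection to integral manifolds. -/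

section Restriction

variable {E : Type*} [NormedAddCommGroup E] [NormedSpace ℝ E] [FiniteDimensional ℝ E]
  {M : Type*} [TopologicalSpace M] [T2Space M] [ChartedSpace E M] [IsManifold 𝓘(ℝ, E) ∞ M]
  {F : Type*} [NormedAddCommGroup F] [NormedSpace ℝ F] [FiniteDimensional ℝ F]
  {N : Type*} [TopologicalSpace N] [ChartedSpace F N] [IsManifold 𝓘(ℝ, F) ∞ N]
  {ι : N → M} {D D' : Distr E M} {cov : LinConn E M}

omit [FiniteDimensional ℝ E] [T2Space M] [FiniteDimensional ℝ F] [IsManifold 𝓘(ℝ, E) ∞ M]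
  [IsManifold 𝓘(ℝ, F) ∞ N] in
lemma IsIntegralManifold.mfderiv_mem (hι : IsIntegralManifold F D ι) (p : N)
    (u : TangentSpace 𝓘(ℝ, F) p) : mfderiv 𝓘(ℝ, F) 𝓘(ℝ, E) ι p u ∈ D (ι p) :=
  hι.tangent p ▸ LinearMap.mem_range_self
    (f := (mfderiv 𝓘(ℝ, F) 𝓘(ℝ, E) ι p).toLinearMap) (x := u)

/-- An ambient field related to Z need not lie in D away from the image of ι. Projecting it to D
repairs this and keeps its values along ι, near p. -/
lemma IsIntegralManifold.exists_section (hι : IsIntegralManifold F D ι)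
    (h : ∀ x, IsCompl (D x) (D' x)) (hp : ∀ V : VF E M, IsSmoothVF V → IsSection D (proj h V))
    {Z : VF F N} (hZ : IsSmoothVF Z) (p : N) : ∃ W : VF E M, IsSection D W ∧ RelatedAt ι p Z W := by
  obtain ⟨W, hW, hZW⟩ := exists_relatedAt (p := p) hι.smooth (hι.immersion p) hZ
  refine ⟨proj h W, hp W hW, ?_⟩
  filter_upwards [hZW] with q hq
  rw [proj_eq_self h (hq ▸ hι.mfderiv_mem q _), hq]

/-- A connection that preserves `D` induces a connection on the integral manifolds of `D`. -/
theorem IsIntegralManifold.exists_restriction [T2Space N] (hι : IsIntegralManifold F D ι)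
    (h : ∀ x, IsCompl (D x) (D' x)) (hp : ∀ V : VF E M, IsSmoothVF V → IsSection D (proj h V))
    (hcov : IsSmoothConn cov) (hD : ∀ X : VF E M, IsSection D X → ∀ x v, cov X x v ∈ D x) :
    ∃ covN : LinConn F N, IsSmoothConn covN ∧ IsRestriction cov ι covN := by
  classical
  have ex : ∀ V Z : VF F N, IsSmoothVF Z → ∃ Y : VF F N,
      ∀ p (W : VF E M), IsSmoothVF W → RelatedAt ι p Z W →
        mfderiv 𝓘(ℝ, F) 𝓘(ℝ, E) ι p (Y p)
          = cov W (ι p) (mfderiv 𝓘(ℝ, F) 𝓘(ℝ, E) ι p (V p)) := fun V Z hZ ↦ by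
    have : ∀ p, ∃ y : TangentSpace 𝓘(ℝ, F) p, ∀ W : VF E M, IsSmoothVF W → RelatedAt ι p Z W →
        mfderiv 𝓘(ℝ, F) 𝓘(ℝ, E) ι p y
          = cov W (ι p) (mfderiv 𝓘(ℝ, F) 𝓘(ℝ, E) ι p (V p)) := fun p ↦ by
      obtain ⟨W, hW, hZW⟩ := hι.exists_section h hp hZ p
      -- The ambient derivative lies in D, the range of dι, so it has a preimage in the tangent
      -- space of N; `linConn_eq_of_eq_comp` makes it independent of W.
      have hm := hD W hW (ι p) (mfderiv 𝓘(ℝ, F) 𝓘(ℝ, E) ι p (V p))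
      rw [← hι.tangent p] at hm
      obtain ⟨y, hy⟩ := hm
      refine ⟨y, fun W' hW' hZW' ↦ Eq.trans hy ?_⟩
      refine linConn_eq_of_eq_comp cov hι.smooth hW.1 hW' ?_ _
      filter_upwards [hZW, hZW'] with q hq hq' using hq.symm.trans hq'
    choose Y hY using this
    exact ⟨Y, hY⟩
  -- The value 0 on fields Z that are not smooth is harmless, since `IsConnOp` concerns smooth
  -- fields only.
  let B : VF F N → VF F N → VF F N := fun V Z ↦ if hZ : IsSmoothVF Z then (ex V Z hZ).choose else 0
  have hB : ∀ {V Z : VF F N}, IsSmoothVF Z → ∀ {p} {W : VF E M}, IsSmoothVF W → RelatedAt ι p Z W →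
      mfderiv 𝓘(ℝ, F) 𝓘(ℝ, E) ι p (B V Z p)
        = cov W (ι p) (mfderiv 𝓘(ℝ, F) 𝓘(ℝ, E) ι p (V p)) := by
    intro V Z hZ p W hW hZW
    simp only [B, dif_pos hZ]
    exact (ex V Z hZ).choose_spec p W hW hZW
  have hop : IsConnOp B := by
    refine ⟨fun V Z hV hZ ↦ ?_, fun V V' Z hV hV' hZ ↦ ?_, fun f V Z hf hV hZ ↦ ?_,
      fun V Z Z' hV hZ hZ' ↦ ?_, fun f V Z hf hV hZ ↦ ?_⟩
    · refine isSmoothVF_of_relatedAt hι.smooth hι.immersion fun p ↦ ?_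
      obtain ⟨W, hW, hZW⟩ := exists_relatedAt (p := p) hι.smooth (hι.immersion p) hZ
      obtain ⟨U, hU, hVU⟩ := exists_relatedAt (p := p) hι.smooth (hι.immersion p) hV
      refine ⟨fun y ↦ cov W y (U y), hcov.smoothVF hU hW, ?_⟩
      filter_upwards [hZW.eventually_nhds, hVU] with q hq hq'
      rw [hB hZ hW hq, hq']
    all_goals
      funext p
      apply hι.immersion p
      obtain ⟨W, hW, hZW⟩ := exists_relatedAt (p := p) hι.smooth (hι.immersion p) hZ
    · rw [hB hZ hW hZW, Pi.add_apply, Pi.add_apply, map_add, map_add, map_add, hB hZ hW hZW,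
        hB hZ hW hZW]
    · rw [hB hZ hW hZW, Pi.smul_apply', Pi.smul_apply', map_smul, map_smul, map_smul,
        hB hZ hW hZW]
    · obtain ⟨W', hW', hZW'⟩ := exists_relatedAt (p := p) hι.smooth (hι.immersion p) hZ'
      rw [hB (hZ.add hZ') (hW.add hW') (hZW.add hZW'), Pi.add_apply, map_add, hB hZ hW hZW,
        hB hZ' hW' hZW', linConn_add cov hW hW', add_apply]
    · obtain ⟨g, hg, hgf⟩ := exists_extension hι.smooth (hι.immersion p) hf
      rw [hB (hZ.smul hf) (hW.smul hg) (hZW.smul hgf), linConn_smul cov hg hW, Pi.add_apply,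
        Pi.smul_apply', Pi.smul_apply', map_add, map_smul, map_smul, hB hZ hW hZW,
        hZW.self_of_nhds, ← dirDeriv_comp hι.smooth hg, dirDeriv_congr hgf, hgf.self_of_nhds,
        add_comm]
  obtain ⟨covN, hs, hcovN⟩ := hop.exists_linConn
  refine ⟨covN, hs, fun p Z W hZ hW hZW u ↦ ?_⟩
  obtain ⟨V, hV, rfl⟩ := exists_smoothVF_eq p u
  rw [hcovN V Z hV hZ, hB hZ hW hZW]

/-- A connection that preserves `D`, is flat along `D`, and is torsion free along `D` induces flat
affine structures on the integral manifolds of `D`. -/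
theorem IsIntegralManifold.restrictsToFlatAffineStructure (hι : IsIntegralManifold F D ι)
    (h : ∀ x, IsCompl (D x) (D' x)) (hp : ∀ V : VF E M, IsSmoothVF V → IsSection D (proj h V))
    (hcov : IsSmoothConn cov) (hD : ∀ X : VF E M, IsSection D X → ∀ x v, cov X x v ∈ D x)
    (htor : ∀ X X' : VF E M, IsSection D X → IsSection D X' → ∀ x,
      cov X' x (X x) - cov X x (X' x) = mlieBracket 𝓘(ℝ, E) X X' x)
    (hcurv : ∀ X X' V : VF E M, IsSection D X → IsSection D X' → IsSmoothVF V → ∀ x,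
      curvature cov X X' V x = 0) :
    RestrictsToFlatAffineStructure F cov ι := by
  -- N is Hausdorff because it injects continuously into M; bump functions on N depend on this.
  have : T2Space N := .of_injective_continuous hι.injective hι.smooth.continuous
  obtain ⟨covN, hs, hr⟩ := hι.exists_restriction h hp hcov hD
  refine ⟨covN, hr, ⟨hs, fun p ↦ ?_, fun X Y Z hX hY hZ p ↦ ?_⟩, fun covN' hr' Z hZ p ↦ ?_⟩
  · ext u v
    obtain ⟨X, hX, rfl⟩ := exists_smoothVF_eq p u
    obtain ⟨Y, hY, rfl⟩ := exists_smoothVF_eq p v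
    apply hι.immersion p
    obtain ⟨U, hU, hXU⟩ := hι.exists_section h hp hX p
    obtain ⟨V, hV, hYV⟩ := hι.exists_section h hp hY p
    rw [covN.torsion_apply (hX.mdiffAt p) (hY.mdiffAt p), map_sub, map_sub,
      hr p Y V hY hV.1 hYV, hr p X U hX hU.1 hXU,
      RelatedAt.mlieBracket hι.smooth hX hY hU.1 hV.1 hXU hYV, hXU.self_of_nhds,
      hYV.self_of_nhds, htor U V hU hV, sub_self]
    exact (map_zero _).symm
  · apply hι.immersion p
    obtain ⟨U, hU, hXU⟩ := hι.exists_section h hp hX p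
    obtain ⟨V, hV, hYV⟩ := hι.exists_section h hp hY p
    obtain ⟨W, hW, hZW⟩ := hι.exists_section h hp hZ p
    -- Covariant derivatives of related fields are again related, so the formula for second
    -- derivatives on N maps to the one on M.
    have aux : ∀ {A : VF F N} {C : VF E M}, RelatedAt ι p A C →
        RelatedAt ι p (fun q ↦ covN Z q (A q)) (fun y ↦ cov W y (C y)) := fun {A C} hA ↦ by
      filter_upwards [hA, hZW.eventually_nhds] with q hq hq'
      rw [hr q Z W hZ hW.1 hq', hq]
    have hc := hcurv U V W hU hV hW.1 (ι p)
    rw [curvature] at hc ⊢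
    rw [map_sub, map_sub, map_zero, ← hc,
      hr p _ _ (hs.smoothVF hY hZ) (hcov.smoothVF hV.1 hW.1) (aux hYV),
      hr p _ _ (hs.smoothVF hX hZ) (hcov.smoothVF hU.1 hW.1) (aux hXU), hr p Z W hZ hW.1 hZW,
      RelatedAt.mlieBracket hι.smooth hX hY hU.1 hV.1 hXU hYV, hXU.self_of_nhds,
      hYV.self_of_nhds]
  · ext u
    apply hι.immersion p
    obtain ⟨W, hW, hZW⟩ := exists_relatedAt (p := p) hι.smooth (hι.immersion p) hZ
    rw [hr' p Z W hZ hW hZW, hr p Z W hZ hW hZW]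

end Restriction

end KSymp

end

theorem mainTheorem6 {E : Type*} [NormedAddCommGroup E] [NormedSpace ℝ E]
    [FiniteDimensional ℝ E]
    {M : Type*} [TopologicalSpace M] [T2Space M] [ChartedSpace E M]
    [IsManifold 𝓘(ℝ, E) ∞ M]
    (n k : ℕ) (Ω : Fin k → KSymp.BilinField E M) (L Q : KSymp.Distr E M)
    (hM : KSymp.IsKSymplectic n k Ω L) (hQ : KSymp.IsAdmissible n Ω L Q) :
    ∃ cov : KSymp.LinConn E M,
      -- `cov` is the canonical connection, the only one with its defining properties
      KSymp.IsCanonicalConnection Ω L Q cov ∧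
      (∀ cov' : KSymp.LinConn E M, KSymp.IsCanonicalConnection Ω L Q cov' →
        ∀ W : KSymp.VF E M, KSymp.IsSmoothVF W → ∀ x, cov' W x = cov W x) ∧
      -- its curvature vanishes along the leaves of the two foliations
      (∀ X X' V : KSymp.VF E M, KSymp.IsSection L X → KSymp.IsSection L X' →
        KSymp.IsSmoothVF V → ∀ x, KSymp.curvature cov X X' V x = 0) ∧
      (∀ Y Y' V : KSymp.VF E M, KSymp.IsSection Q Y → KSymp.IsSection Q Y' →
        KSymp.IsSmoothVF V → ∀ x, KSymp.curvature cov Y Y' V x = 0) ∧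
      -- the leaves of the two foliations carry canonical flat affine structures
      (∀ (N : Type*) [TopologicalSpace N] [ChartedSpace (EuclideanSpace ℝ (Fin (n * k))) N]
        [IsManifold 𝓘(ℝ, EuclideanSpace ℝ (Fin (n * k))) ∞ N] (ι : N → M),
        KSymp.IsIntegralManifold (EuclideanSpace ℝ (Fin (n * k))) L ι →
          KSymp.RestrictsToFlatAffineStructure (EuclideanSpace ℝ (Fin (n * k))) cov ι) ∧
      (∀ (N : Type*) [TopologicalSpace N] [ChartedSpace (EuclideanSpace ℝ (Fin n)) N]
        [IsManifold 𝓘(ℝ, EuclideanSpace ℝ (Fin n)) ∞ N] (ι : N → M),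
        KSymp.IsIntegralManifold (EuclideanSpace ℝ (Fin n)) Q ι →
          KSymp.RestrictsToFlatAffineStructure (EuclideanSpace ℝ (Fin n)) cov ι) := by
  obtain ⟨cov, hs, hc⟩ := KSymp.exists_isAdaptedConn hM hQ
  have hcan := hc.isCanonicalConnection hM hQ hs
  have hL : ∀ X X' V : KSymp.VF E M, KSymp.IsSection L X → KSymp.IsSection L X' →
      KSymp.IsSmoothVF V → ∀ x, KSymp.curvature cov X X' V x = 0 :=
    fun X X' V hX hX' hV x ↦ KSymp.curvature_L hM hQ hc hs hX hX' hV x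
  have hQQ : ∀ Y Y' V : KSymp.VF E M, KSymp.IsSection Q Y → KSymp.IsSection Q Y' →
      KSymp.IsSmoothVF V → ∀ x, KSymp.curvature cov Y Y' V x = 0 :=
    fun Y Y' V hY hY' hV x ↦ KSymp.curvature_Q hM hQ hc hs hY hY' hV x
  refine ⟨cov, hcan, fun cov' hc' W hW x ↦ hc.unique hM hQ (hc'.isAdaptedConn hM hQ) hW x, hL, hQQ,
    fun N _ _ _ ι hι ↦ ?_, fun N _ _ _ ι hι ↦ ?_⟩
  · exact hι.restrictsToFlatAffineStructure hQ.transversal (fun V hV ↦ .proj_L hM hQ hV) hs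
      (fun X hX x v ↦ hc.mem_L hM hQ hX x v) (fun X X' hX hX' x ↦ KSymp.torsion_L hM hQ hc hX hX' x)
      hL
  · exact hι.restrictsToFlatAffineStructure (fun x ↦ (hQ.transversal x).symm)
      (fun V hV ↦ .proj_Q hM hQ hV) hs (fun Y hY x v ↦ hc.mem_Q hM hQ hY x v)
      (fun Y Y' hY hY' x ↦ KSymp.torsion_Q hM hQ hc hY hY' x) hQQ
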